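/- Let $k\ge 3$ and let $$A_k=\langle a,b\mid \underbrace{aba\cdots}_{k}=\underbrace{bab\cdots}_{k}\rangle .$$ Write $\mathrm{prod}(s,t;n)=sts\cdots$ ($n$ factors). Put $\sigma_1=a$, $\sigma_2=b$ and, for $3\le j\le k$, $\sigma_j=\mathrm{prod}(b^{-1},a^{-1};j-2)\,\mathrm{prod}(a,b;j-1)$ if $j$ is odd and $\sigma_j=\mathrm{prod}(b^{-1},a^{-1};j-2)\,\mathrm{prod}(b,a;j-1)$ if $j$ is even. Let $\tilde d$ be the word metric $\tilde d(x,y)=\tilde d(e,x^{-1}y)$ on $A_k$ for the dual generators $\sigma_1^{\pm1},\dots,\sigma_k^{\pm1}$, and let $\delta=\sigma_1\sigma_2$. The horofunction compactification $\tilde{\mathcal M}$ of $(A_k,\tilde d)$ is the closure, in $\mathbb Z^{A_k}$ with the product (pointwise convergence) topology, of the set of functions $\tilde d(\cdot,x)-\tilde d(e,x)$, $x\in A_k$. Every $w\in A_k$ has a left normal form $w=\delta^{r}w_1\cdots w_s$ with $r\in\mathbb Z$, $w_i\in\{\sigma_1,\dots,\sigma_k\}$ and $s$ minimal; the numbers $\tilde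 m_2(w):=r$ and $\tilde m_1(w):=s$ depend only on $w$. Put $\tilde\pi(w)=(\tilde m_2(w),\tilde m_1(w)+\tilde m_2(w))\in\mathbb Z^2$ and $\tilde\phi(w,z)=\tilde\pi(w^{-1}z)-\tilde\pi(z)$ for $w,z\in A_k$. Let $\tilde Z$ be the set of finite or infinite words in the letters $\sigma_1,\dots,\sigma_k$ in which no product of two consecutive letters equals $\delta$, with the topology of letterwise convergence (the end of a word counting as a letter), and let $\tilde m_1(z)\in\mathbb N\cup\{\infty\}$ be the number of letters of $z\in\tilde Z$. Let $\tilde\Omega'$ be the set of pairs $(p,z)$ with $p=(p_0,p_1)\in(\mathbb Z\cup\{\pm\infty\})^2$ and $z\in\tilde Z$ such that $p_1-p_0=\tilde m_1(z)$ unless $p=(-\infty,-\infty)$ or $p=(+\infty,+\infty)$, with the topology induced by the product topology. Let $\tilde\Omega$ be the quotient space of $\tilde\Omega'$ obtained by identifying all points $((-\infty,-\infty),z)$ with one another and all points $((+\infty,+\infty),z)$ with one another. Theorem. For all $w\in A_k$ and all $z\in\tilde Z$ the limit $\tilde\phi(w,z):=\lim_{n\to\infty}\tilde\phi(w,z_1\cdots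 z_n)$ exists (for a finite word, $z_1\cdots z_n$ is the whole word as soon as $n$ is at least its length). For $(p,z)\in\tilde\Omega'$ let $$\tilde\psi_{p,z}(w)=|p_0+\tilde\phi_0(w,z)|+|p_1+\tilde\phi_1(w,z)|-|p_0|-|p_1|\qquad(w\in A_k),$$ where finite and infinite parts are tracked separately, so that $|p_i+c|-|p_i|$ equals $c$ if $p_i=+\infty$ and $-c$ if $p_i=-\infty$. Then $(p,z)\mapsto\tilde\psi_{p,z}$ is constant on the identified classes, and the induced map $\tilde\psi$ is a homeomorphism from $\tilde\Omega$ onto $\tilde{\mathcal M}$. -/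

import Mathlib

open Filter Topology

namespace DihedralArtin

/-! ### The group `A_k` and its dual generators -/

/-- The alternating product `s t s t ⋯` with `n` factors. -/
def altProd {M : Type*} [Monoid M] (s t : M) : ℕ → M
  | 0 => 1
  | n + 1 => s * altProd t s n

/-- The Artin group of dihedral type
`A_k = ⟨a, b | a b a ⋯ = b a b ⋯⟩` (`k` factors on each side). -/
abbrev Grp (k : ℕ) : Type :=
  PresentedGroup ({altProd (FreeGroup.of (0 : Fin 2)) (FreeGroup.of 1) k *
    (altProd (FreeGroup.of (1 : Fin 2)) (FreeGroup.of 0) k)⁻¹} : Set (FreeGroup (Fin 2)))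

/-- The Artin generator `a`. -/
def a (k : ℕ) : Grp k := PresentedGroup.of 0

/-- The Artin generator `b`. -/
def b (k : ℕ) : Grp k := PresentedGroup.of 1

/-- The element `σ_{i+1}` of `A_k` (so `i = 0, …, k - 1` gives `σ_1, …, σ_k`):
`σ_1 = a`, `σ_2 = b`, and, for `j ≥ 3`,
`σ_j = prod(b⁻¹, a⁻¹; j - 2) prod(a, b; j - 1)` if `j` is odd and
`σ_j = prod(b⁻¹, a⁻¹; j - 2) prod(b, a; j - 1)` if `j` is even. -/
def sigma (k : ℕ) : ℕ → Grp k
  | 0 => a k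
  | 1 => b k
  | n + 2 =>
    if Odd (n + 3) then altProd (b k)⁻¹ (a k)⁻¹ (n + 1) * altProd (a k) (b k) (n + 2)
    else altProd (b k)⁻¹ (a k)⁻¹ (n + 1) * altProd (b k) (a k) (n + 2)

/-- The positive dual generator `σ_{i+1}` attached to the letter `i`. -/
def gen {k : ℕ} (i : Fin k) : Grp k := sigma k i

/-- The dual Garside element `δ = σ_1 σ_2`. -/
def delta (k : ℕ) : Grp k := sigma k 0 * sigma k 1

/-- The element of `A_k` represented by a finite word of positive dual generators. -/
def wordProd {k : ℕ} (l : List (Fin k)) : Grp k := (l.map gen).prod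

/-! ### The dual-generator word metric and the horofunction compactification -/

/-- The set `{σ_1, …, σ_k, σ_1⁻¹, …, σ_k⁻¹}` of dual generators. -/
def dualGens (k : ℕ) : Set (Grp k) := {g | ∃ i : Fin k, g = gen i ∨ g = (gen i)⁻¹}

/-- The word metric of the dual generators: `dualDist x y` is the least length of a word in the
dual generators that represents `x⁻¹ y`. -/
noncomputable def dualDist {k : ℕ} (x y : Grp k) : ℕ :=
  sInf {n | ∃ l : List (Grp k), l.length = n ∧ (∀ g ∈ l, g ∈ dualGens k) ∧ l.prod = x⁻¹ * y}

/-- The function `d(·, x) - d(e, x)`. -/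
noncomputable def distFun {k : ℕ} (x : Grp k) : Grp k → ℤ :=
  fun w => (dualDist w x : ℤ) - (dualDist 1 x : ℤ)

/-- The horofunction compactification (basepoint `e`): the closure of the set of functions
`d(·, x) - d(e, x)`. As `A_k` is discrete, uniform convergence on compact sets is pointwise
convergence, that is, convergence in the product topology of `A_k → ℤ`. -/
def horoCompactification (k : ℕ) : Set (Grp k → ℤ) :=
  closure (Set.range (distFun (k := k)))

/-! ### Left normal forms -/

/-- `w = δ^r w_1 ⋯ w_s` is a left normal form of `w` (with canonical factors
`w_1, …, w_s ∈ {σ_1, …, σ_k}`): the number `s` of factors is minimal among all such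
decompositions of `w`. -/
def IsLeftNormalForm {k : ℕ} (w : Grp k) (r : ℤ) (l : List (Fin k)) : Prop :=
  w = delta k ^ r * wordProd l ∧
    ∀ (r' : ℤ) (l' : List (Fin k)), w = delta k ^ r' * wordProd l' → l.length ≤ l'.length

/-- `m̃₁(w)`: the number of canonical factors in a left normal form of `w`. -/
noncomputable def mOne {k : ℕ} (w : Grp k) : ℕ :=
  Classical.epsilon fun s => ∃ r l, IsLeftNormalForm w r l ∧ l.length = s

/-- `m̃₂(w)`: the exponent of `δ` in a left normal form of `w`. -/
noncomputable def mTwo {k : ℕ} (w : Grp k) : ℤ :=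
  Classical.epsilon fun r => ∃ l, IsLeftNormalForm w r l

/-- `π̃(w) = (m̃₂(w), m̃₁(w) + m̃₂(w))`. -/
noncomputable def piMap {k : ℕ} (w : Grp k) : ℤ × ℤ := (mTwo w, (mOne w : ℤ) + mTwo w)

/-- `φ̃(w, z) = π̃(w⁻¹ z) - π̃(z)` for `w, z ∈ A_k`. -/
noncomputable def phi {k : ℕ} (w z : Grp k) : ℤ × ℤ := piMap (w⁻¹ * z) - piMap z

/-! ### Existence of left normal forms; `m̃₁` and `m̃₂` are well defined -/

section WellDefined

variable {k : ℕ}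

theorem altProd_even {G : Type*} [Monoid G] (s t : G) (m : ℕ) :
    altProd s t (2 * m) = (s * t) ^ m := by
  induction m with
  | zero => simp [altProd]
  | succ m ih =>
    rw [show 2 * (m + 1) = 2 * m + 1 + 1 by ring, altProd, altProd, ih, pow_succ', mul_assoc]

theorem altProd_odd {G : Type*} [Monoid G] (s t : G) (m : ℕ) :
    altProd s t (2 * m + 1) = (s * t) ^ m * s := by
  rw [altProd, altProd_even]
  induction m with
  | zero => simp
  | succ m ih => rw [pow_succ', pow_succ', mul_assoc, mul_assoc, ← ih]; simp [mul_assoc]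

theorem b_eq (k : ℕ) : b k = (a k)⁻¹ * delta k := (inv_mul_cancel_left (a k) (b k)).symm

theorem sigma_even (k m : ℕ) : sigma k (2 * m) = (delta k ^ m)⁻¹ * a k * delta k ^ m := by
  rcases m with _ | m
  · simp [sigma]
  · have h : Odd (2 * m + 3) := ⟨m + 1, by ring⟩
    rw [show 2 * (m + 1) = 2 * m + 2 by ring, sigma, if_pos h,
      show 2 * m + 2 = 2 * (m + 1) by ring, altProd_even, altProd_odd, ← mul_inv_rev,
      show a k * b k = delta k from rfl, b_eq, pow_succ' (delta k) m]
    simp [mul_assoc]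

theorem sigma_odd (k m : ℕ) : sigma k (2 * m + 1) = (delta k ^ m)⁻¹ * b k * delta k ^ m := by
  rcases m with _ | m
  · simp [sigma]
  · have h : ¬ Odd (2 * m + 1 + 3) := by rw [Nat.not_odd_iff_even]; exact ⟨m + 2, by ring⟩
    rw [show 2 * (m + 1) + 1 = (2 * m + 1) + 2 by ring, sigma, if_neg h,
      show 2 * m + 1 + 2 = 2 * (m + 1) + 1 by ring, show 2 * m + 1 + 1 = 2 * (m + 1) by ring,
      altProd_even, altProd, altProd_even, ← mul_inv_rev, show a k * b k = delta k from rfl,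
      inv_pow, mul_assoc]

theorem sigma_mul_delta (k n : ℕ) : sigma k n * delta k = delta k * sigma k (n + 2) := by
  rcases Nat.even_or_odd' n with ⟨m, rfl | rfl⟩
  · rw [show 2 * m + 2 = 2 * (m + 1) by ring, sigma_even, sigma_even, pow_succ (delta k) m]
    simp [mul_assoc]
  · rw [show 2 * m + 1 + 2 = 2 * (m + 1) + 1 by ring, sigma_odd, sigma_odd,
      pow_succ (delta k) m]
    simp [mul_assoc]

/-- `σ_j σ_{j+1} = δ`. -/
theorem sigma_mul_sigma (k n : ℕ) : sigma k n * sigma k (n + 1) = delta k := by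
  rcases Nat.even_or_odd' n with ⟨m, rfl | rfl⟩
  · rw [sigma_even, sigma_odd, b_eq]
    simp [mul_assoc, ((Commute.refl (delta k)).pow_right m).eq]
  · rw [show 2 * m + 1 + 1 = 2 * (m + 1) by ring, sigma_even, sigma_odd, b_eq,
      pow_succ' (delta k) m]
    simp [mul_assoc, ((Commute.refl (delta k)).pow_right m).eq]

theorem map_altProd {M N : Type*} [Monoid M] [Monoid N] (f : M →* N) (s t : M) (n : ℕ) :
    f (altProd s t n) = altProd (f s) (f t) n := by
  induction n generalizing s t with
  | zero => simp [altProd]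
  | succ n ih => simp [altProd, ih]

theorem artin_rel (k : ℕ) : altProd (a k) (b k) k = altProd (b k) (a k) k := by
  have h : PresentedGroup.mk ({altProd (FreeGroup.of (0 : Fin 2)) (FreeGroup.of 1) k *
      (altProd (FreeGroup.of (1 : Fin 2)) (FreeGroup.of 0) k)⁻¹} : Set (FreeGroup (Fin 2)))
      (altProd (FreeGroup.of (0 : Fin 2)) (FreeGroup.of 1) k *
      (altProd (FreeGroup.of (1 : Fin 2)) (FreeGroup.of 0) k)⁻¹) = 1 :=
    PresentedGroup.one_of_mem (by simp)
  rw [map_mul, map_inv, map_altProd, map_altProd, mul_inv_eq_one] at h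
  exact h

theorem sigma_of_rel (n : ℕ) (h : altProd (a k) (b k) n = altProd (b k) (a k) n) :
    sigma k n = a k := by
  rcases Nat.even_or_odd' n with ⟨m, rfl | rfl⟩
  · have h2 : altProd (a k) (b k) (2 * m + 1) = altProd (a k) (b k) (2 * m) * a k := by
      rw [altProd_odd, altProd_even]
    rw [altProd, ← h, altProd_even, show a k * b k = delta k from rfl] at h2
    rw [sigma_even, mul_assoc, h2, inv_mul_cancel_left]
  · rw [altProd_odd, altProd, altProd_even, show a k * b k = delta k from rfl] at h
    rw [sigma_odd, mul_assoc, ← h, inv_mul_cancel_left]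

theorem sigma_self (k : ℕ) : sigma k k = sigma k 0 := sigma_of_rel k (artin_rel k)

theorem sigma_self_succ (k : ℕ) : sigma k (k + 1) = sigma k 1 := by
  have h := (sigma_mul_sigma k k).trans (sigma_mul_sigma k 0).symm
  rw [sigma_self] at h
  exact mul_left_cancel h

/-- Conjugation by `δ` permutes the positive dual generators. -/
theorem exists_delta_mul_gen (hk : 3 ≤ k) (i : Fin k) :
    ∃ j : Fin k, delta k * gen i = gen j * delta k := by
  obtain ⟨i, hi⟩ := i
  match i with
  | 0 =>
    refine ⟨⟨k - 2, by omega⟩, ?_⟩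
    have := sigma_mul_delta k (k - 2)
    rw [show k - 2 + 2 = k by omega, sigma_self] at this
    exact this.symm
  | 1 =>
    refine ⟨⟨k - 1, by omega⟩, ?_⟩
    have := sigma_mul_delta k (k - 1)
    rw [show k - 1 + 2 = k + 1 by omega, sigma_self_succ] at this
    exact this.symm
  | n + 2 => exact ⟨⟨n, by omega⟩, (sigma_mul_delta k n).symm⟩

theorem exists_delta_mul_wordProd (hk : 3 ≤ k) (l : List (Fin k)) :
    ∃ l' : List (Fin k), delta k * wordProd l = wordProd l' * delta k := by
  induction l with
  | nil => exact ⟨[], by simp [wordProd]⟩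
  | cons i l ih =>
    obtain ⟨l', hl⟩ := ih
    obtain ⟨j, hj⟩ := exists_delta_mul_gen hk i
    refine ⟨j :: l', ?_⟩
    simp only [wordProd, List.map_cons, List.prod_cons] at hl ⊢
    rw [← mul_assoc, hj, mul_assoc, hl, mul_assoc]

/-- Every element of `A_k` is of the form `δ^r w_1 ⋯ w_s`. -/
theorem exists_decomposition (hk : 3 ≤ k) (w : Grp k) :
    ∃ (r : ℤ) (l : List (Fin k)), w = delta k ^ r * wordProd l := by
  let P : Grp k → Prop := fun w => ∃ (r : ℤ) (l : List (Fin k)), w = delta k ^ r * wordProd l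
  have hg : ∀ w (i : Fin k), P w → P (w * gen i) := by
    rintro _ i ⟨r, l, rfl⟩
    exact ⟨r, l ++ [i], by simp [wordProd, mul_assoc]⟩
  have hd : ∀ w, P w → P (w * (delta k)⁻¹) := by
    rintro _ ⟨r, l, rfl⟩
    obtain ⟨l', hl⟩ := exists_delta_mul_wordProd hk l
    refine ⟨r - 1, l', ?_⟩
    rw [mul_assoc, zpow_sub_one, mul_assoc]
    congr 1
    rw [eq_inv_mul_iff_mul_eq, ← mul_assoc, hl, mul_inv_cancel_right]
  have ha : ∀ w, P w → P (w * a k) := fun w h => hg w ⟨0, by omega⟩ h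
  have hb : ∀ w, P w → P (w * b k) := fun w h => hg w ⟨1, by omega⟩ h
  have ha' : ∀ w, P w → P (w * (a k)⁻¹) := by
    intro w h
    have := hd _ (hb _ h)
    simpa [delta, sigma, mul_assoc] using this
  have hb' : ∀ w, P w → P (w * (b k)⁻¹) := by
    intro w h
    have := ha _ (hd _ h)
    simpa [delta, sigma, mul_assoc] using this
  have hw : w ∈ Subgroup.closure (Set.range (PresentedGroup.of (rels := {altProd
      (FreeGroup.of (0 : Fin 2)) (FreeGroup.of 1) k *
      (altProd (FreeGroup.of (1 : Fin 2)) (FreeGroup.of 0) k)⁻¹}))) := by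
    rw [PresentedGroup.closure_range_of]; trivial
  induction hw using Subgroup.closure_induction_right with
  | one => exact ⟨0, [], by simp [wordProd]⟩
  | mul_right x _ y hy ih =>
    obtain ⟨i, rfl⟩ := hy
    fin_cases i
    exacts [ha _ ih, hb _ ih]
  | mul_inv_cancel x _ y hy ih =>
    obtain ⟨i, rfl⟩ := hy
    fin_cases i
    exacts [ha' _ ih, hb' _ ih]

theorem exists_isLeftNormalForm (hk : 3 ≤ k) (w : Grp k) : ∃ r l, IsLeftNormalForm w r l := by
  classical
  have h : ∃ n, ∃ (r : ℤ) (l : List (Fin k)), w = delta k ^ r * wordProd l ∧ l.length = n := by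
    obtain ⟨r, l, h⟩ := exists_decomposition hk w
    exact ⟨_, r, l, h, rfl⟩
  obtain ⟨r, l, hw, hl⟩ := Nat.find_spec h
  exact ⟨r, l, hw, fun r' l' h' => hl ▸ Nat.find_min' h ⟨r', l', h', rfl⟩⟩

/-- The homomorphism `A_k → ℤ` that maps `a` and `b` to `1`. -/
def degree (k : ℕ) : Grp k →* Multiplicative ℤ :=
  PresentedGroup.toGroup (f := fun _ => Multiplicative.ofAdd (1 : ℤ)) (by
    rintro _ rfl
    simp [map_altProd])

theorem degree_delta (k : ℕ) : degree k (delta k) = Multiplicative.ofAdd 2 := by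
  rw [delta, map_mul]
  exact congrArg₂ (· * ·) (PresentedGroup.toGroup.of _) (PresentedGroup.toGroup.of _)

theorem degree_sigma (k n : ℕ) : degree k (sigma k n) = Multiplicative.ofAdd 1 := by
  induction n with
  | zero => exact PresentedGroup.toGroup.of _
  | succ n ih =>
    have h := congrArg (degree k) (sigma_mul_sigma k n)
    rw [map_mul, ih, degree_delta] at h
    exact mul_left_cancel (h.trans rfl)

theorem degree_decomposition (r : ℤ) (l : List (Fin k)) :
    (degree k (delta k ^ r * wordProd l)).toAdd = 2 * r + l.length := by
  have h : (degree k (wordProd l)).toAdd = l.length := by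
    induction l with
    | nil => simp [wordProd]
    | cons i l ih =>
      simp only [wordProd, List.map_cons, List.prod_cons] at ih ⊢
      rw [map_mul, toAdd_mul, ih, gen, degree_sigma]
      simp; ring
  rw [map_mul, toAdd_mul, h, map_zpow, degree_delta, toAdd_zpow]
  simp; ring

/-- The numbers `m̃₁(w)` and `m̃₂(w)` do not depend on the left normal form of `w`. -/
theorem IsLeftNormalForm.eq {w : Grp k} {r : ℤ} {l : List (Fin k)}
    (h : IsLeftNormalForm w r l) : mOne w = l.length ∧ mTwo w = r := by
  have key : ∀ {r' l'}, IsLeftNormalForm w r' l' → l'.length = l.length ∧ r' = r := by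
    intro r' l' h'
    have h1 : l'.length = l.length := le_antisymm (h'.2 _ _ h.1) (h.2 _ _ h'.1)
    have h2 := degree_decomposition r l
    rw [← h.1, h'.1, degree_decomposition] at h2
    exact ⟨h1, by omega⟩
  obtain ⟨r₁, l₁, h₁, e₁⟩ : ∃ r₁ l₁, IsLeftNormalForm w r₁ l₁ ∧ l₁.length = mOne w :=
    Classical.epsilon_spec (p := fun s => ∃ r l, IsLeftNormalForm w r l ∧ l.length = s)
      ⟨_, r, l, h, rfl⟩
  obtain ⟨l₂, h₂⟩ : ∃ l₂, IsLeftNormalForm w (mTwo w) l₂ :=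
    Classical.epsilon_spec (p := fun r => ∃ l, IsLeftNormalForm w r l) ⟨r, l, h⟩
  exact ⟨e₁ ▸ (key h₁).1, (key h₂).2⟩

end WellDefined

/-! ### Possibly infinite δ-free positive words -/

/-- A finite or infinite word in the letters `σ_1, …, σ_k` in which no two consecutive letters have
product `δ`. The value `none` marks the positions after the end of the word. -/
structure Word (k : ℕ) where
  letter : ℕ → Option (Fin k)
  ended : ∀ n, letter n = none → letter (n + 1) = none
  deltaFree : ∀ n i j, letter n = some i → letter (n + 1) = some j → gen i * gen j ≠ delta k

/-- Letterwise convergence: a sequence of words converges iff, at each position, the letter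
(or the fact that the word has ended) is eventually that of the limit. -/
instance (k : ℕ) : TopologicalSpace (Word k) :=
  TopologicalSpace.induced Word.letter
    (@Pi.topologicalSpace ℕ (fun _ => Option (Fin k)) (fun _ => ⊥))

/-- The number of letters of a word, that is, `m̃₁` of the word; it is `⊤` for an infinite word. -/
noncomputable def Word.length {k : ℕ} (z : Word k) : ℕ∞ := Set.encard {n | z.letter n ≠ none}

/-- The group element `z_1 ⋯ z_n` given by the first `n` letters of `z` (by the whole word if it has
at most `n` letters). -/
def Word.prefixProd {k : ℕ} (z : Word k) (n : ℕ) : Grp k :=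
  wordProd ((List.range n).filterMap z.letter)

/-- `φ̃(w, z)` for a possibly infinite word `z`: the limit of `φ̃(w, z_1 ⋯ z_n)`. For a finite word
this sequence is eventually constant, equal to `φ̃` of `w` and the element given by `z`. -/
noncomputable def phiWord {k : ℕ} (w : Grp k) (z : Word k) : ℤ × ℤ :=
  limUnder atTop fun n => phi w (z.prefixProd n)

/-! ### The parameter space -/

/-- The inclusion of the extended integers in the extended reals. -/
noncomputable def toEReal : EInt → EReal :=
  WithBotTop.rec (motive := fun _ => EReal) ⊥ (fun n : ℤ => ((n : ℝ) : EReal)) ⊤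

/-- The space `Ω̃'` of pairs `(p, z)` such that `p_1 - p_0 = m̃₁(z)` unless `p` is identically `-∞`
or identically `+∞`, with the topology induced from the product topology. -/
def PreOmega (k : ℕ) : Type :=
  {x : (EInt × EInt) × Word k // x.1 ≠ (⊥, ⊥) → x.1 ≠ (⊤, ⊤) →
    toEReal x.1.2 - toEReal x.1.1 = ((x.2.length : ENNReal) : EReal)}

noncomputable instance (k : ℕ) : TopologicalSpace (PreOmega k) := instTopologicalSpaceSubtype

/-- All points `((-∞, -∞), z)` are equivalent, and all points `((+∞, +∞), z)` are equivalent. -/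
instance omegaSetoid (k : ℕ) : Setoid (PreOmega k) where
  r x y := x = y ∨ (x.1.1 = (⊥, ⊥) ∧ y.1.1 = (⊥, ⊥)) ∨ (x.1.1 = (⊤, ⊤) ∧ y.1.1 = (⊤, ⊤))
  iseqv := by
    refine ⟨fun x => Or.inl rfl, fun {x y} h => ?_, fun {x y z} h h' => ?_⟩
    · rcases h with h | h | h
      · exact Or.inl h.symm
      · exact Or.inr (Or.inl h.symm)
      · exact Or.inr (Or.inr h.symm)
    · rcases h with rfl | h | h
      · exact h'
      · rcases h' with rfl | h' | h'
        · exact Or.inr (Or.inl h)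
        · exact Or.inr (Or.inl ⟨h.1, h'.2⟩)
        · exact absurd (h.2.symm.trans h'.1) (by simp)
      · rcases h' with rfl | h' | h'
        · exact Or.inr (Or.inr h)
        · exact absurd (h.2.symm.trans h'.1) (by simp)
        · exact Or.inr (Or.inr ⟨h.1, h'.2⟩)

/-- The space `Ω̃`, with the quotient topology. -/
abbrev Omega (k : ℕ) : Type := Quotient (omegaSetoid k)

/-- `|p + c| - |p|` for an extended integer `p` and an integer `c`, where infinite and finite parts
are tracked separately: `|+∞ + c| = ∞ + c` and `|-∞ + c| = ∞ - c`, so that the difference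
is `c` for `p = +∞` and `-c` for `p = -∞`. -/
def absShift (p : EInt) (c : ℤ) : ℤ :=
  WithBotTop.rec (motive := fun _ => ℤ) (-c) (fun n : ℤ => |n + c| - |n|) c p

/-- `ψ̃_{p,z}(w) = |p_0 + φ̃_0(w,z)| + |p_1 + φ̃_1(w,z)| - |p_0| - |p_1|`. -/
noncomputable def psi {k : ℕ} (x : PreOmega k) : Grp k → ℤ :=
  fun w => absShift x.1.1.1 (phiWord w x.1.2).1 + absShift x.1.1.2 (phiWord w x.1.2).2

end DihedralArtin

namespace DihedralArtin

/-! ### A faithful model of `A_k` -/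

section Model

variable {k : ℕ}

/-! With indices read modulo `k`, the relations are `σ_i σ_{i+1} = δ`, and moving `δ` past a letter
shifts its index by two. Every element is therefore some `z δ^r` with `z` a `δ`-free word. For
uniqueness, let `A_k` act on the set of formal pairs `(z, r)` by left multiplication: the orbit of
the empty pair computes the normal form (`normalAction`, `eval_nf`, `nf_eval`).

Left multiplication by a letter raises exactly one coordinate of `π̃` by one: the first if the
letter completes a `δ` with the head of the word, the second otherwise (`piMap_gen_mul`). Hence the
dual length is `|π̃_0| + |π̃_1|` (`dualDist_eq`), and the distance function of `x = z δ^r` is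
`ψ̃_{p,z}` with `p = π̃(x)`. Since a fixed `w` touches only boundedly many letters of `z`, with a
bound independent of `z` (`exists_phi_wordProd_append`), `φ̃(w, ·)` extends to infinite words and is
locally constant.

It remains to compare compact spaces. The parameter space is closed in a compact product and `ψ̃` is
continuous, so its image is closed and contains all distance functions; conversely, truncating `z`
and adjusting the power of `δ` exhibits each `ψ̃_{p,z}` as a limit of distance functions
(`range_psi`). The value of `ψ̃_{p,z}` on powers of `δ` recovers `p`; unless `p` is constantly
infinite, further test elements then recover the letters of `z` one by one (`equiv_of_psi_eq`). At
the two infinite corners only `φ̃_0 + φ̃_1` matters, which does not depend on `z`. A continuous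
bijection from a compact space onto a Hausdorff space is a homeomorphism. -/

theorem wordProd_cons (i : Fin k) (l : List (Fin k)) : wordProd (i :: l) = gen i * wordProd l := by
  simp [wordProd]

theorem wordProd_append (l m : List (Fin k)) : wordProd (l ++ m) = wordProd l * wordProd m := by
  simp [wordProd]

variable [NeZero k]

/-- No letter is followed by its cyclic successor. -/
abbrev DeltaFree (l : List (Fin k)) : Prop := l.IsChain fun i j => j ≠ i + 1

/-- Left multiplication by `σ_i` on the pair `(z, r)`, which stands for `z δ^r`. -/
def consLetter (i : Fin k) : List (Fin k) × ℤ → List (Fin k) × ℤ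
  | ([], r) => ([i], r)
  | (j :: t, r) => if j = i + 1 then (t.map (· - 2), r + 1) else (i :: j :: t, r)

theorem DeltaFree.map_sub {l : List (Fin k)} (h : DeltaFree l) (c : Fin k) :
    DeltaFree (l.map (· - c)) := by
  rw [DeltaFree, List.isChain_map]
  refine h.imp fun i j hij h => hij ?_
  have := congrArg (· + c) h
  simpa [sub_add_cancel, add_right_comm _ 1 c] using this

theorem DeltaFree.consLetter {x : List (Fin k) × ℤ} (h : DeltaFree x.1) (i : Fin k) :
    DeltaFree (consLetter i x).1 := by
  obtain ⟨_ | ⟨j, t⟩, r⟩ := x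
  · simp [DihedralArtin.consLetter]
  · simp only [DihedralArtin.consLetter]
    split_ifs with hj
    · exact DeltaFree.map_sub (List.IsChain.tail h) 2
    · exact List.isChain_cons_cons.2 ⟨hj, h⟩

theorem consLetter_of_deltaFree {i : Fin k} {l : List (Fin k)} (h : DeltaFree (i :: l)) (r : ℤ) :
    consLetter i (l, r) = (i :: l, r) := by
  cases l with
  | nil => rfl
  | cons j t => exact if_neg (List.isChain_cons_cons.1 h).1

/-- The relation `σ_i σ_{i+1} = δ` on formal normal forms. Either `i + 1` is prepended and then
absorbed by `i`, or it absorbs a head `i + 2`; in that case the shifted tail may follow `i`, so `i`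
is prepended, which is the shifted old head. -/
theorem consLetter_consLetter (i : Fin k) {x : List (Fin k) × ℤ} (h : DeltaFree x.1) :
    consLetter i (consLetter (i + 1) x) = (x.1.map (· - 2), x.2 + 1) := by
  have h2 : i + 1 + 1 - 2 = i := by grind
  obtain ⟨_ | ⟨j, t⟩, r⟩ := x
  · simp [consLetter]
  · by_cases hj : j = i + 1 + 1
    · subst hj
      have : DeltaFree (i :: t.map (· - 2)) := by
        have := DeltaFree.map_sub h 2
        rwa [List.map_cons, h2] at this
      rw [List.map_cons, h2, ← consLetter_of_deltaFree this]
      simp [consLetter]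
    · simp [consLetter, hj]

variable (k) in
/-- The normal forms `z δ^r` with `z` a `δ`-free word. -/
abbrev Reduced : Type := {x : List (Fin k) × ℤ // DeltaFree x.1}

/-- Left multiplication by `σ_i` on normal forms. -/
def letterMap (i : Fin k) (x : Reduced k) : Reduced k := ⟨consLetter i x.1, x.2.consLetter i⟩

variable (k) in
/-- Left multiplication by `δ` on normal forms. -/
def deltaPerm : Equiv.Perm (Reduced k) where
  toFun x := ⟨(x.1.1.map (· - 2), x.1.2 + 1), x.2.map_sub 2⟩
  -- Subtracting `0 - 2` adds two, in the shape to which `map_sub` applies.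
  invFun x := ⟨(x.1.1.map (· - (0 - 2)), x.1.2 - 1), x.2.map_sub _⟩
  left_inv x := Subtype.ext <| Prod.ext
    (by simp only [List.map_map]; exact List.map_id'' (fun i => by simp) _) (by simp)
  right_inv x := Subtype.ext <| Prod.ext
    (by simp only [List.map_map]; exact List.map_id'' (fun i => by simp) _) (by simp)

theorem letterMap_letterMap (i : Fin k) (x : Reduced k) :
    letterMap i (letterMap (i + 1) x) = deltaPerm k x :=
  Subtype.ext (consLetter_consLetter i x.2)

/-- Each letter map is the inner factor of one factorisation of the bijection `deltaPerm` and the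
outer factor of another. -/
theorem letterMap_bijective (i : Fin k) : Function.Bijective (letterMap i) := by
  constructor
  · have h : Function.Injective (letterMap (i - 1) ∘ letterMap (i - 1 + 1)) := by
      rw [show letterMap (i - 1) ∘ letterMap (i - 1 + 1) = deltaPerm k from
        funext (letterMap_letterMap _)]
      exact (deltaPerm k).injective
    rw [show i - 1 + 1 = i by grind] at h
    exact h.of_comp
  · have h : Function.Surjective (letterMap i ∘ letterMap (i + 1)) := by
      rw [show letterMap i ∘ letterMap (i + 1) = deltaPerm k from funext (letterMap_letterMap _)]
      exact (deltaPerm k).surjective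
    exact h.of_comp

/-- Left multiplication by `σ_i` as a permutation of the normal forms. -/
noncomputable def letterPerm (i : Fin k) : Equiv.Perm (Reduced k) :=
  Equiv.ofBijective (letterMap i) (letterMap_bijective i)

theorem letterPerm_mul (i : Fin k) : letterPerm i * letterPerm (i + 1) = deltaPerm k :=
  Equiv.ext (letterMap_letterMap i)

/-- The braid relation for a cyclic sequence whose consecutive terms have constant product. -/
theorem altProd_comm {G : Type*} [Group G] {x : ℕ → G} {d : G} (h : ∀ n, x n * x (n + 1) = d)
    {n : ℕ} (hn : x n = x 0) : altProd (x 0) (x 1) n = altProd (x 1) (x 0) n := by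
  have hd : ∀ n, x n * d = d * x (n + 2) := fun n => by
    rw [← h (n + 1), ← mul_assoc, h, h (n + 1)]
  have hm : ∀ m, x 0 * d ^ m = d ^ m * x (2 * m) := fun m => by
    induction m with
    | zero => simp
    | succ m ih => rw [pow_succ, ← mul_assoc, ih, mul_assoc, hd, ← mul_assoc]; rfl
  have hr : ∀ m, x 0 * (x 1 * x 0) ^ m = d ^ m * x 0 := fun m => by
    rw [← h 0]
    induction m with
    | zero => simp
    | succ m ih => rw [pow_succ, ← mul_assoc, ih, pow_succ]; simp [mul_assoc]
  -- An extra factor `x 0` on the left turns `(x 1 * x 0) ^ m` into a power of `d` times `x 0`, so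
  -- that both sides can be compared by moving `d`.
  apply mul_left_cancel (a := x 0)
  rcases Nat.even_or_odd' n with ⟨m, rfl | rfl⟩
  · rw [altProd_even, altProd_even, hr, h 0, hm, hn]
  · rw [altProd_odd, altProd_odd, ← mul_assoc, ← mul_assoc, hr, h 0, hm, mul_assoc, mul_assoc,
      h 0, ← hn, h]

/-! ### The action of `A_k` on normal forms -/

theorem ofNat_succ (n : ℕ) : Fin.ofNat k (n + 1) = Fin.ofNat k n + 1 :=
  Fin.ext (by simp [Fin.val_add])

variable (k) in
/-- The action of `A_k` on normal forms by left multiplication. -/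
noncomputable def normalAction : Grp k →* Equiv.Perm (Reduced k) :=
  PresentedGroup.toGroup (f := ![letterPerm 0, letterPerm 1]) (by
    rintro _ rfl
    rw [map_mul, map_inv, map_altProd, map_altProd, mul_inv_eq_one]
    simp only [FreeGroup.lift_apply_of, Matrix.cons_val_zero, Matrix.cons_val_one]
    have h := altProd_comm (x := fun n => letterPerm (Fin.ofNat k n)) (d := deltaPerm k)
      (fun n => by rw [← letterPerm_mul (Fin.ofNat k n)]; rw [ofNat_succ])
      (n := k) (by simp)
    exact h)

/-- Both the `σ`'s and the letter permutations have constant consecutive products, so each term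
determines the next and agreement at the start propagates. -/
theorem normalAction_sigma (n : ℕ) : normalAction k (sigma k n) = letterPerm (Fin.ofNat k n) := by
  have h0 : normalAction k (sigma k 0) = letterPerm 0 := PresentedGroup.toGroup.of _
  have h1 : normalAction k (sigma k 1) = letterPerm 1 := PresentedGroup.toGroup.of _
  induction n with
  | zero => exact h0
  | succ n ih =>
    have h := congrArg (normalAction k)
      ((sigma_mul_sigma k n).trans (sigma_mul_sigma k 0).symm)
    rw [map_mul, map_mul, ih, h0, h1] at h
    refine mul_left_cancel (h.trans ?_)
    rw [ofNat_succ, letterPerm_mul, ← letterPerm_mul 0, zero_add]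

theorem normalAction_gen (i : Fin k) : normalAction k (gen i) = letterPerm i := by
  rw [gen, normalAction_sigma]
  congr 1
  simp

theorem normalAction_delta : normalAction k (delta k) = deltaPerm k := by
  rw [delta, map_mul, normalAction_sigma, normalAction_sigma, ofNat_succ,
    letterPerm_mul]

/-- Only the wrap-around from the last letter to the first needs the Artin relation, through
`sigma_self`. -/
theorem gen_mul_gen_succ (i : Fin k) : gen i * gen (i + 1) = delta k := by
  rcases eq_or_ne (i.val + 1) k with h | h
  · have h' : i + 1 = 0 := by
      rw [← Fin.ofNat_val_eq_self i, ← ofNat_succ, h]; simp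
    rw [h', ← sigma_mul_sigma k i, h, sigma_self]
    rfl
  · have h' : (i + 1).val = i.val + 1 := by
      rw [← Fin.ofNat_val_eq_self i, ← ofNat_succ]
      simp [Nat.mod_eq_of_lt (show i.val + 1 < k by omega)]
    rw [gen, gen, h', sigma_mul_sigma]

theorem gen_mul_delta (i : Fin k) : gen i * delta k = delta k * gen (i + 2) := by
  have h : gen (i + 1) * gen (i + 2) = delta k := by
    rw [← gen_mul_gen_succ (i + 1), show i + 1 + 1 = i + 2 by grind]
  rw [← h, ← mul_assoc, gen_mul_gen_succ, h]

/-- The element of `A_k` represented by `(z, r)`, that is, `z δ^r`. -/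
def eval (x : List (Fin k) × ℤ) : Grp k := wordProd x.1 * delta k ^ x.2

theorem delta_mul_wordProd_map (l : List (Fin k)) :
    wordProd (l.map (· - 2)) * delta k = delta k * wordProd l := by
  induction l with
  | nil => simp [wordProd]
  | cons i l ih =>
    rw [List.map_cons, wordProd_cons, mul_assoc, ih, wordProd_cons, ← mul_assoc, gen_mul_delta,
      sub_add_cancel, mul_assoc]

theorem eval_consLetter (i : Fin k) (x : List (Fin k) × ℤ) :
    eval (consLetter i x) = gen i * eval x := by
  obtain ⟨_ | ⟨j, t⟩, r⟩ := x
  · simp [consLetter, eval, wordProd]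
  · simp only [consLetter]
    split_ifs with hj
    · subst hj
      rw [eval, eval, zpow_add_one, (Commute.self_zpow (delta k) r).symm.eq, ← mul_assoc,
        delta_mul_wordProd_map, wordProd_cons, ← gen_mul_gen_succ i]
      simp only [mul_assoc]
    · simp [eval, wordProd_cons, mul_assoc]

/-- Evaluation intertwines the formal action with multiplication in `A_k`; applied to the empty
normal form it shows that `nf w` represents `w`. -/
theorem eval_normalAction (w : Grp k) (x : Reduced k) :
    eval (normalAction k w x).1 = w * eval x.1 := by
  have hg : ∀ (i : Fin k) (x : Reduced k),
      eval (normalAction k (gen i) x).1 = gen i * eval x.1 := fun i x => by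
    rw [normalAction_gen]
    exact eval_consLetter i x.1
  have hgen : ∀ i : Fin 2, ∃ j : Fin k, (PresentedGroup.of i : Grp k) = gen j := by
    have h0 : gen (0 : Fin k) = a k := rfl
    refine Fin.forall_fin_two.2 ⟨⟨0, rfl⟩, 1, ?_⟩
    have := gen_mul_gen_succ (0 : Fin k)
    rw [zero_add] at this
    exact (mul_left_cancel this).symm
  have hw : w ∈ Subgroup.closure (Set.range (PresentedGroup.of (rels := {altProd
      (FreeGroup.of (0 : Fin 2)) (FreeGroup.of 1) k *
      (altProd (FreeGroup.of (1 : Fin 2)) (FreeGroup.of 0) k)⁻¹}))) := by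
    rw [PresentedGroup.closure_range_of]; trivial
  induction hw using Subgroup.closure_induction generalizing x with
  | mem w hw =>
    obtain ⟨i, rfl⟩ := hw
    obtain ⟨j, hj⟩ := hgen i
    rw [hj, hg]
  | one => simp
  | mul u v _ _ hu hv => rw [map_mul, Equiv.Perm.mul_apply, hu, hv, mul_assoc]
  | inv u _ hu =>
    rw [eq_inv_mul_iff_mul_eq, ← hu, ← Equiv.Perm.mul_apply, ← map_mul, mul_inv_cancel, map_one,
      Equiv.Perm.one_apply]

/-- The normal form `z δ^r` of an element of `A_k`. -/
noncomputable def nf (w : Grp k) : Reduced k := normalAction k w ⟨([], 0), List.isChain_nil⟩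

/-! ### Uniqueness and minimality of normal forms -/

theorem nf_mul (v w : Grp k) : nf (v * w) = normalAction k v (nf w) := by
  rw [nf, map_mul, Equiv.Perm.mul_apply, nf]

theorem nf_gen_mul (i : Fin k) (w : Grp k) : (nf (gen i * w)).1 = consLetter i (nf w).1 := by
  rw [nf_mul, normalAction_gen]; rfl

theorem nf_delta_mul (w : Grp k) :
    (nf (delta k * w)).1 = ((nf w).1.1.map (· - 2), (nf w).1.2 + 1) := by
  rw [nf_mul, normalAction_delta]; rfl

theorem eval_nf (w : Grp k) : eval (nf w).1 = w := by
  rw [nf, eval_normalAction]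
  simp [eval, wordProd]

theorem nf_delta_zpow_mul (r : ℤ) (w : Grp k) :
    (nf (delta k ^ r * w)).1.1.length = (nf w).1.1.length ∧
      (nf (delta k ^ r * w)).1.2 = (nf w).1.2 + r := by
  induction r with
  | zero => simp
  | succ r ih =>
    rw [← mul_self_zpow, mul_assoc, nf_delta_mul]
    rw [zpow_natCast, ← zpow_natCast (delta k) r]
    exact ⟨by simpa using ih.1, by simp only [ih.2]; ring⟩
  | pred r ih =>
    have h := nf_delta_mul (delta k ^ (-(r : ℤ) - 1) * w)
    rw [← mul_assoc, mul_self_zpow, sub_add_cancel] at h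
    rw [h] at ih
    simp at ih
    exact ⟨ih.1, by linarith [ih.2]⟩

/-- Uniqueness: when a `δ`-free word is built up from its end, no letter is ever absorbed. -/
theorem nf_eval {l : List (Fin k)} (h : DeltaFree l) (r : ℤ) : (nf (eval (l, r))).1 = (l, r) := by
  induction l with
  | nil =>
    have h := nf_delta_zpow_mul r (1 : Grp k)
    simp [nf] at h
    simp [eval, wordProd]
    exact Prod.ext (by simpa [nf] using h.1) (by simpa [nf] using h.2)
  | cons i l ih =>
    rw [eval, wordProd_cons, mul_assoc, nf_gen_mul]
    rw [eval] at ih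
    rw [ih h.tail, consLetter_of_deltaFree h]

/-- A letter is either prepended or absorbed, so it lengthens the word by at most one. This yields
the minimality required of left normal forms. -/
theorem length_nf_wordProd_mul_le (l : List (Fin k)) (w : Grp k) :
    (nf (wordProd l * w)).1.1.length ≤ l.length + (nf w).1.1.length := by
  induction l with
  | nil => simp [wordProd]
  | cons i l ih =>
    rw [wordProd_cons, mul_assoc, nf_gen_mul]
    refine le_trans (b := (nf (wordProd l * w)).1.1.length + 1) ?_ (by simp; omega)
    generalize (nf (wordProd l * w)).1 = x
    obtain ⟨_ | ⟨j, t⟩, r⟩ := x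
    · simp [consLetter]
    · simp only [consLetter]
      split_ifs
      · simp; omega
      · simp

/-- Powers of `δ` can be moved to the left of a word. -/
theorem exists_wordProd_mul_delta_zpow (l : List (Fin k)) (r : ℤ) :
    ∃ l' : List (Fin k), l'.length = l.length ∧
      wordProd l * delta k ^ r = delta k ^ r * wordProd l' := by
  induction r with
  | zero => exact ⟨l, rfl, by simp⟩
  | succ r ih =>
    obtain ⟨l', hl, h⟩ := ih
    refine ⟨l'.map (· + 2), by simpa, ?_⟩
    have h2 := delta_mul_wordProd_map (l'.map (· + 2))
    rw [List.map_map, show ((· - 2) ∘ (· + 2) : Fin k → Fin k) = id by ext; simp, List.map_id] at h2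
    rw [zpow_add_one, ← mul_assoc, h, mul_assoc, h2, mul_assoc]
  | pred r ih =>
    obtain ⟨l', hl, h⟩ := ih
    refine ⟨l'.map (· - 2), by simpa, ?_⟩
    rw [zpow_sub_one, ← mul_assoc, h, mul_assoc, mul_assoc]
    congr 1
    rw [mul_inv_eq_iff_eq_mul, mul_assoc, delta_mul_wordProd_map, inv_mul_cancel_left]

theorem mOne_eq_and_mTwo_eq (w : Grp k) :
    mOne w = (nf w).1.1.length ∧ mTwo w = (nf w).1.2 := by
  -- `nf` keeps the power of `δ` on the right, a left normal form on the left; the passage preserves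
  -- the exponent and the number of letters.
  obtain ⟨l, hl, h⟩ := exists_wordProd_mul_delta_zpow (nf w).1.1 (nf w).1.2
  have hw : IsLeftNormalForm w (nf w).1.2 l := by
    refine ⟨(eval_nf w).symm.trans h, fun r' l' h' => ?_⟩
    rw [hl, h', (nf_delta_zpow_mul _ _).1]
    simpa [nf] using length_nf_wordProd_mul_le l' 1
  exact hl ▸ hw.eq

end Model
end DihedralArtin

namespace DihedralArtin

/-! ### The map `π̃` and the word metric -/

section Metric

variable {k : ℕ} [NeZero k]

theorem piMap_eq (w : Grp k) :
    piMap w = ((nf w).1.2, ((nf w).1.1.length : ℤ) + (nf w).1.2) := by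
  rw [piMap, (mOne_eq_and_mTwo_eq w).1, (mOne_eq_and_mTwo_eq w).2]

theorem nf_wordProd {l : List (Fin k)} (h : DeltaFree l) : (nf (wordProd l)).1 = (l, 0) := by
  simpa [eval] using nf_eval h 0

theorem gen_injective : Function.Injective (gen : Fin k → Grp k) := fun i j h => by
  have hi := nf_wordProd (List.isChain_singleton i)
  have hj := nf_wordProd (List.isChain_singleton j)
  simp only [wordProd, List.map_cons, List.map_nil, List.prod_singleton] at hi hj
  rw [h, hj] at hi
  simpa using hi.symm

theorem gen_mul_gen_eq_delta_iff {i j : Fin k} : gen i * gen j = delta k ↔ j = i + 1 := by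
  rw [← gen_mul_gen_succ i, mul_right_inj, gen_injective.eq_iff]

theorem piMap_wordProd {l : List (Fin k)} (h : DeltaFree l) :
    piMap (wordProd l) = (0, (l.length : ℤ)) := by
  simp [piMap_eq, nf_wordProd h]

/-- An absorbed letter costs one letter and gains one `δ`, which leaves `m̃₁ + m̃₂` fixed; a
prepended letter leaves `m̃₂` fixed. -/
theorem piMap_gen_mul (i : Fin k) (w : Grp k) :
    piMap (gen i * w) = piMap w + if (nf w).1.1.head? = some (i + 1) then (1, 0) else (0, 1) := by
  rw [piMap_eq, piMap_eq, nf_gen_mul]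
  generalize (nf w).1 = x
  obtain ⟨_ | ⟨j, t⟩, r⟩ := x
  · simp [consLetter]; ring
  · by_cases hj : j = i + 1
    · simp [consLetter, hj]; ring
    · simp [consLetter, hj]; ring

theorem piMap_delta_zpow_mul (r : ℤ) (w : Grp k) : piMap (delta k ^ r * w) = piMap w + (r, r) := by
  rw [piMap_eq, piMap_eq, (nf_delta_zpow_mul r w).1, (nf_delta_zpow_mul r w).2]
  simp [add_assoc]

theorem nf_mul_delta_zpow (w : Grp k) (r : ℤ) :
    (nf (w * delta k ^ r)).1 = ((nf w).1.1, (nf w).1.2 + r) := by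
  have h : w * delta k ^ r = eval ((nf w).1.1, (nf w).1.2 + r) := by
    conv_lhs => rw [← eval_nf w]
    rw [eval, eval, zpow_add, mul_assoc]
  rw [h, nf_eval (nf w).2]

theorem piMap_mul_delta_zpow (w : Grp k) (r : ℤ) : piMap (w * delta k ^ r) = piMap w + (r, r) := by
  rw [piMap_eq, piMap_eq, nf_mul_delta_zpow]
  simp [add_assoc]

theorem piMap_fst_add_snd (w : Grp k) :
    (piMap w).1 + (piMap w).2 = (degree k w).toAdd := by
  conv_rhs => rw [← eval_nf w]
  have h := degree_decomposition (nf w).1.2 (nf w).1.1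
  rw [piMap_eq, eval, map_mul, mul_comm, ← map_mul, h]
  ring

/-- `|m̃₂(w)| + |m̃₁(w) + m̃₂(w)|`, the length of `w` in the dual generators. -/
noncomputable def dualNorm (w : Grp k) : ℤ := |(piMap w).1| + |(piMap w).2|

theorem abs_dualNorm_gen_mul_sub_le (i : Fin k) (w : Grp k) :
    |dualNorm (gen i * w) - dualNorm w| ≤ 1 := by
  rw [dualNorm, piMap_gen_mul, dualNorm]
  split_ifs <;> simp only [Prod.fst_add, Prod.snd_add] <;> grind

theorem dualNorm_prod_le {l : List (Grp k)} (h : ∀ g ∈ l, g ∈ dualGens k) :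
    dualNorm l.prod ≤ l.length := by
  induction l with
  | nil => simp [dualNorm, piMap_eq, nf]
  | cons g l ih =>
    rw [List.forall_mem_cons] at h
    have ih := ih h.2
    obtain ⟨i, rfl | rfl⟩ := h.1
    · have := abs_le.1 (abs_dualNorm_gen_mul_sub_le i l.prod)
      simp only [List.prod_cons, List.length_cons]
      push_cast
      linarith
    · have := abs_le.1 (abs_dualNorm_gen_mul_sub_le i ((gen i)⁻¹ * l.prod))
      rw [mul_inv_cancel_left] at this
      simp only [List.prod_cons, List.length_cons]
      push_cast
      linarith

/-- The descent step showing that `dualNorm` is attained by a word in the dual generators: some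
neighbour has one coordinate of `π̃` closer to zero and the other unchanged. -/
theorem exists_dualNorm_lt {w : Grp k} (h : w ≠ 1) :
    ∃ g v : Grp k, g ∈ dualGens k ∧ w = g * v ∧ dualNorm w = dualNorm v + 1 := by
  have hw : eval (nf w).1 = w := eval_nf w
  have hfree : DeltaFree (nf w).1.1 := (nf w).2
  generalize (nf w).1 = x at hw hfree
  obtain ⟨_ | ⟨i, t⟩, r⟩ := x
  · have hr : r ≠ 0 := by
      rintro rfl
      exact h (by rw [← hw]; simp [eval, wordProd])
    have hwr : w = delta k ^ r := by rw [← hw]; simp [eval, wordProd]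
    have hpi : piMap w = (r, r) := by
      rw [hwr, ← one_mul (delta k ^ r), piMap_mul_delta_zpow]
      simp [piMap_eq, nf]
    rcases lt_or_gt_of_ne hr with hr | hr
    · refine ⟨(gen 0)⁻¹, gen 0 * w, ⟨0, Or.inr rfl⟩, by simp, ?_⟩
      have hn : (nf w).1.1 = [] := by rw [← hw, nf_eval List.isChain_nil]
      rw [dualNorm, dualNorm, piMap_gen_mul, hpi, hn]
      simp
      grind
    -- Here one `δ` is split into two letters, and removing the first lowers the second coordinate
    -- from `r` to `r - 1`... while the remaining letter stands before `δ ^ (r - 1)`; the norm is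
    -- then `2 * r - 1`.
    · refine ⟨gen 0, wordProd [0 + 1] * delta k ^ (r - 1), ⟨0, Or.inl rfl⟩, ?_, ?_⟩
      · simp only [wordProd, List.map_cons, List.map_nil, List.prod_singleton]
        rw [← mul_assoc, gen_mul_gen_succ, ← hw]
        simp [eval, wordProd, mul_self_zpow]
      · rw [dualNorm, dualNorm, piMap_mul_delta_zpow, hpi,
          piMap_wordProd (List.isChain_singleton _)]
        simp
        grind
  · have hpi : piMap w = (r, (t.length : ℤ) + 1 + r) := by
      rw [← hw, piMap_eq, nf_eval hfree]
      simp
    -- If the second coordinate is positive, deleting the head lowers it. Otherwise `r` is negative,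
    -- and a letter that absorbs the head raises the first coordinate towards zero.
    by_cases hr : 0 < (t.length : ℤ) + 1 + r
    · refine ⟨gen i, eval (t, r), ⟨i, Or.inl rfl⟩, ?_, ?_⟩
      · rw [← hw, eval, eval, wordProd_cons, mul_assoc]
      · rw [dualNorm, dualNorm, hpi, piMap_eq, nf_eval (l := t) hfree.tail]
        simp only
        grind
    · refine ⟨(gen (i - 1))⁻¹, gen (i - 1) * w, ⟨_, Or.inr rfl⟩, by simp, ?_⟩
      have hn : (nf w).1.1 = i :: t := by rw [← hw, nf_eval hfree]
      rw [dualNorm, dualNorm, piMap_gen_mul, hpi, hn, if_pos (by simp)]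
      simp
      grind

theorem exists_prod_eq (n : ℕ) {w : Grp k} (h : dualNorm w = n) :
    ∃ l : List (Grp k), l.length = n ∧ (∀ g ∈ l, g ∈ dualGens k) ∧ l.prod = w := by
  induction n generalizing w with
  | zero =>
    by_cases hw : w = 1
    · exact ⟨[], rfl, by simp, by simp [hw]⟩
    · obtain ⟨g, v, -, -, hv⟩ := exists_dualNorm_lt hw
      have : 0 ≤ dualNorm v := by rw [dualNorm]; positivity
      simp at h
      omega
  | succ n ih =>
    have hw : w ≠ 1 := by
      rintro rfl
      simp [dualNorm, piMap_eq, nf] at h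
      omega
    obtain ⟨g, v, hg, rfl, hv⟩ := exists_dualNorm_lt hw
    obtain ⟨l, hl, hl', rfl⟩ := ih (w := v) (by push_cast at h; linarith)
    exact ⟨g :: l, by simp [hl], List.forall_mem_cons.2 ⟨hg, hl'⟩, by simp⟩

theorem dualDist_eq (x y : Grp k) : (dualDist x y : ℤ) = dualNorm (x⁻¹ * y) := by
  obtain ⟨n, hn⟩ := Int.eq_ofNat_of_zero_le (a := dualNorm (x⁻¹ * y)) (by rw [dualNorm]; positivity)
  have h := exists_prod_eq n hn
  have : dualDist x y ∈ {n | ∃ l : List (Grp k), l.length = n ∧ (∀ g ∈ l, g ∈ dualGens k) ∧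
      l.prod = x⁻¹ * y} := Nat.sInf_mem ⟨n, h⟩
  obtain ⟨l, hl, hl', hp⟩ := this
  have h1 := dualNorm_prod_le hl'
  rw [hp, hl] at h1
  have h2 : dualDist x y ≤ n := Nat.sInf_le h
  omega

theorem distFun_eq (x w : Grp k) :
    distFun x w = |(piMap x).1 + (phi w x).1| + |(piMap x).2 + (phi w x).2|
      - |(piMap x).1| - |(piMap x).2| := by
  simp only [distFun, dualDist_eq, dualNorm, phi, Prod.fst_sub, Prod.snd_sub, inv_one, one_mul]
  ring_nf

end Metric

/-! ### `φ̃` depends on a bounded number of letters -/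

section Locality

variable {k : ℕ} [NeZero k]

theorem nf_wordProd_mul (y : List (Fin k)) (w : Grp k) :
    (nf (wordProd y * w)).1 = y.foldr consLetter (nf w).1 := by
  induction y with
  | nil => simp [wordProd]
  | cons i y ih => rw [wordProd_cons, mul_assoc, nf_gen_mul, ih, List.foldr_cons]

/-- Each letter of `y` consumes at most one letter of `u`, so `v` is only relabelled by shifts. The
length bound in the conclusion keeps the induction going: it ensures that a letter of `u'` is left
to meet the next letter of `y`. -/
theorem foldr_consLetter_append (y : List (Fin k)) {u : List (Fin k)} (v : List (Fin k)) (r : ℤ)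
    (h : y.length ≤ u.length) : ∃ (u' : List (Fin k)) (r' : ℤ) (f : Fin k → Fin k),
      y.foldr consLetter (u, r) = (u', r') ∧ y.foldr consLetter (u ++ v, r) = (u' ++ v.map f, r') ∧
      u.length ≤ u'.length + y.length := by
  induction y with
  | nil => exact ⟨u, r, id, rfl, by simp, by simp⟩
  | cons i y ih =>
    obtain ⟨u', r', f, h1, h2, h3⟩ := ih (by simp at h; omega)
    rw [List.foldr_cons, List.foldr_cons, h1, h2]
    obtain _ | ⟨j, t⟩ := u'
    · simp at h h3
      omega
    · by_cases hj : j = i + 1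
      · exact ⟨t.map (· - 2), r' + 1, fun x => f x - 2, by simp [consLetter, hj],
          by simp [consLetter, hj, Function.comp_def], by simp at h3 ⊢; omega⟩
      · exact ⟨i :: j :: t, r', f, by simp [consLetter, hj], by simp [consLetter, hj],
          by simp at h3 ⊢; omega⟩

theorem exists_phi_wordProd_append (hk : 3 ≤ k) (w : Grp k) : ∃ N : ℕ, ∀ u v : List (Fin k),
    DeltaFree (u ++ v) → N ≤ u.length → phi w (wordProd (u ++ v)) = phi w (wordProd u) := by
  obtain ⟨r, y, hw⟩ := exists_decomposition hk w⁻¹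
  -- The power of `δ` shifts `π̃` uniformly, so only the letters of `y` reach into the word; the
  -- length of the untouched `v` cancels in the difference.
  refine ⟨y.length, fun u v huv hu => ?_⟩
  obtain ⟨u', r', f, h1, h2, -⟩ := foldr_consLetter_append y v 0 hu
  rw [phi, phi, hw, mul_assoc, mul_assoc, piMap_delta_zpow_mul, piMap_delta_zpow_mul,
    piMap_eq (wordProd y * _), piMap_eq (wordProd y * _), nf_wordProd_mul, nf_wordProd_mul,
    nf_wordProd huv, nf_wordProd huv.left_of_append, h1, h2, piMap_wordProd huv,
    piMap_wordProd huv.left_of_append]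
  ext
  · simp
  · simp
    ring

end Locality
end DihedralArtin

namespace DihedralArtin

/-! ### Prefixes of words -/

namespace Word

variable {k : ℕ}

@[ext] theorem ext {z z' : Word k} (h : ∀ n, z.letter n = z'.letter n) : z = z' := by
  cases z; cases z'; congr; exact funext h

theorem letter_eq_none_of_le (z : Word k) {m n : ℕ} (h : z.letter m = none) (hmn : m ≤ n) :
    z.letter n = none := by
  induction n, hmn using Nat.le_induction with
  | base => exact h
  | succ n _ ih => exact z.ended n ih

theorem letter_ne_none_of_le (z : Word k) {m n : ℕ} (h : z.letter n ≠ none) (hmn : m ≤ n) :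
    z.letter m ≠ none := fun hm => h (z.letter_eq_none_of_le hm hmn)

theorem length_cases (z : Word k) : ((∀ n, z.letter n ≠ none) ∧ z.length = ⊤) ∨
    ∃ N : ℕ, (∀ n, z.letter n = none ↔ N ≤ n) ∧ z.length = N := by
  by_cases h : ∃ n, z.letter n = none
  · right
    classical
    have hN : ∀ n, z.letter n = none ↔ Nat.find h ≤ n := fun n =>
      ⟨fun hn => Nat.find_min' h hn, z.letter_eq_none_of_le (Nat.find_spec h)⟩
    refine ⟨Nat.find h, hN, ?_⟩
    have : {n | z.letter n ≠ none} = (Finset.range (Nat.find h) : Set ℕ) := by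
      ext n
      simp [← not_le, ← hN n]
    rw [length, this, Set.encard_coe_eq_coe_finsetCard, Finset.card_range]
  · left
    push Not at h
    refine ⟨h, ?_⟩
    rw [length, Set.eq_univ_of_forall (s := {n | z.letter n ≠ none}) h, Set.encard_univ]
    simp

/-- The list of the first `n` letters of a word. -/
def take (z : Word k) (n : ℕ) : List (Fin k) := (List.range n).filterMap z.letter

theorem prefixProd_eq (z : Word k) (n : ℕ) : z.prefixProd n = wordProd (z.take n) := rfl

theorem take_succ (z : Word k) (n : ℕ) : z.take (n + 1) = z.take n ++ (z.letter n).toList := by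
  rw [take, List.range_succ, List.filterMap_append, take]
  cases h : z.letter n <;> simp [h]

theorem length_take (z : Word k) {n : ℕ} (h : ∀ m < n, z.letter m ≠ none) :
    (z.take n).length = n := by
  induction n with
  | zero => rfl
  | succ n ih =>
    rw [take_succ, List.length_append, ih fun m hm => h m (by omega)]
    obtain ⟨j, hj⟩ := Option.ne_none_iff_exists'.1 (h n (by omega))
    simp [hj]

theorem take_of_letter_eq_none (z : Word k) {m n : ℕ} (h : z.letter m = none) (hmn : m ≤ n) :
    z.take n = z.take m := by
  induction n, hmn using Nat.le_induction with
  | base => rfl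
  | succ n hn ih => rw [take_succ, ih, z.letter_eq_none_of_le h hn]; simp

theorem exists_take_append (z : Word k) {m n : ℕ} (hmn : m ≤ n) :
    ∃ v, z.take n = z.take m ++ v ∧ (z.letter m = none → v = []) := by
  by_cases h : z.letter m = none
  · exact ⟨[], by simp [z.take_of_letter_eq_none h hmn], fun _ => rfl⟩
  · induction n, hmn using Nat.le_induction with
    | base => exact ⟨[], by simp, fun _ => rfl⟩
    | succ n _ ih =>
      obtain ⟨v, hv, -⟩ := ih
      exact ⟨v ++ (z.letter n).toList, by rw [take_succ, hv, List.append_assoc],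
        fun h' => absurd h' h⟩

theorem take_getElem? (z : Word k) (n i : ℕ) :
    (z.take n)[i]? = if i < n then z.letter i else none := by
  induction n with
  | zero => simp [take]
  | succ n ih =>
    cases hn : z.letter n with
    | none =>
      rw [take_succ, hn, Option.toList_none, List.append_nil, ih]
      grind
    | some j =>
      have hl : (z.take n).length = n := z.length_take fun m hm =>
        z.letter_ne_none_of_le (n := n) (by simp [hn]) hm.le
      rw [take_succ, List.getElem?_append, ih, hl, hn]
      grind

theorem take_congr {z z' : Word k} {n : ℕ} (h : ∀ m < n, z.letter m = z'.letter m) :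
    z.take n = z'.take n :=
  List.filterMap_congr fun m hm => h m (List.mem_range.1 hm)

variable [NeZero k]

theorem deltaFree_take (z : Word k) (n : ℕ) : DeltaFree (z.take n) := by
  rw [DeltaFree, List.isChain_iff_getElem]
  intro i hi h
  have h1 : (z.take n)[i]? = some (z.take n)[i] := List.getElem?_eq_getElem _
  have h2 : (z.take n)[i + 1]? = some (z.take n)[i + 1] := List.getElem?_eq_getElem _
  rw [take_getElem?] at h1 h2
  refine z.deltaFree i _ _ (by grind) (by grind) (gen_mul_gen_eq_delta_iff.2 h)

/-- A finite word. -/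
def ofList (l : List (Fin k)) (h : DeltaFree l) : Word k where
  letter n := l[n]?
  ended n hn := by simp at hn ⊢; omega
  deltaFree n i j hi hj := by
    rw [Ne, gen_mul_gen_eq_delta_iff]
    obtain ⟨hi', rfl⟩ := List.getElem?_eq_some_iff.1 hi
    obtain ⟨hj', rfl⟩ := List.getElem?_eq_some_iff.1 hj
    exact List.isChain_iff_getElem.1 h n hj'

theorem take_ofList {l : List (Fin k)} (h : DeltaFree l) {n : ℕ} (hn : l.length ≤ n) :
    (ofList l h).take n = l := by
  apply List.ext_getElem?
  intro i
  rw [take_getElem?]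
  change (if i < n then l[i]? else none) = _
  grind

theorem length_ofList {l : List (Fin k)} (h : DeltaFree l) : (ofList l h).length = l.length := by
  have hl : ∀ n, (ofList l h).letter n = none ↔ l.length ≤ n := fun n => List.getElem?_eq_none_iff
  obtain ⟨h1, -⟩ | ⟨N, h1, h2⟩ := (ofList l h).length_cases
  · exact absurd ((hl _).2 le_rfl) (h1 _)
  · rw [h2]
    have := (h1 _).1 ((hl _).2 le_rfl)
    have := (hl _).1 ((h1 _).2 le_rfl)
    congr 1
    omega

end Word

section Limit

variable {k : ℕ} [NeZero k]

theorem exists_phi_prefixProd_eq (hk : 3 ≤ k) (w : Grp k) : ∃ N : ℕ, ∀ (z : Word k) (n : ℕ),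
    N ≤ n → phi w (z.prefixProd n) = phi w (z.prefixProd N) := by
  obtain ⟨N, hN⟩ := exists_phi_wordProd_append hk w
  refine ⟨N, fun z n hn => ?_⟩
  obtain ⟨v, hv, hv'⟩ := z.exists_take_append hn
  rw [Word.prefixProd_eq, Word.prefixProd_eq, hv]
  by_cases h : z.letter N = none
  · rw [hv' h, List.append_nil]
  · exact hN _ _ (hv ▸ z.deltaFree_take n)
      (z.length_take fun m hm => z.letter_ne_none_of_le h hm.le).ge

theorem tendsto_phi_prefixProd (hk : 3 ≤ k) (w : Grp k) (z : Word k) :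
    Tendsto (fun n => phi w (z.prefixProd n)) atTop (𝓝 (phiWord w z)) := by
  obtain ⟨N, hN⟩ := exists_phi_prefixProd_eq hk w
  exact tendsto_nhds_limUnder
    ⟨_, tendsto_const_nhds.congr' ((eventually_ge_atTop N).mono fun n hn => (hN z n hn).symm)⟩

/-- The bound is uniform in `z`, which makes `phiWord w` locally constant. -/
theorem exists_phiWord_eq (hk : 3 ≤ k) (w : Grp k) : ∃ N : ℕ, ∀ (z : Word k) (n : ℕ),
    N ≤ n → phiWord w z = phi w (z.prefixProd n) := by
  obtain ⟨N, hN⟩ := exists_phi_prefixProd_eq hk w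
  refine ⟨N, fun z n hn => (tendsto_nhds_unique (tendsto_phi_prefixProd hk w z) ?_).trans
    (hN z n hn).symm⟩
  exact tendsto_const_nhds.congr' ((eventually_ge_atTop N).mono fun n hn => (hN z n hn).symm)

theorem phiWord_ofList (hk : 3 ≤ k) (w : Grp k) {l : List (Fin k)} (h : DeltaFree l) :
    phiWord w (Word.ofList l h) = phi w (wordProd l) := by
  obtain ⟨N, hN⟩ := exists_phiWord_eq hk w
  rw [hN _ (max N l.length) (le_max_left _ _), Word.prefixProd_eq,
    Word.take_ofList h (le_max_right _ _)]

/-- The sum of the coordinates of `π̃` is the degree, a homomorphism, so the contribution of `z`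
cancels. -/
theorem phiWord_fst_add_snd (hk : 3 ≤ k) (w : Grp k) (z : Word k) :
    (phiWord w z).1 + (phiWord w z).2 = -(degree k w).toAdd := by
  obtain ⟨N, hN⟩ := exists_phiWord_eq hk w
  have h1 := piMap_fst_add_snd (w⁻¹ * z.prefixProd N)
  have h2 := piMap_fst_add_snd (z.prefixProd N)
  rw [map_mul, map_inv, toAdd_mul, toAdd_inv] at h1
  rw [hN z N le_rfl, phi, Prod.fst_sub, Prod.snd_sub]
  linarith

end Limit
end DihedralArtin

namespace DihedralArtin

/-! ### Extended integers and `absShift` -/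

section EInt

@[simp] theorem absShift_bot (c : ℤ) : absShift ⊥ c = -c := rfl

@[simp] theorem absShift_top (c : ℤ) : absShift ⊤ c = c := rfl

@[simp] theorem absShift_coe (p c : ℤ) : absShift (p : EInt) c = |p + c| - |p| := rfl

@[simp] theorem toEReal_bot : toEReal ⊥ = ⊥ := rfl

@[simp] theorem toEReal_top : toEReal ⊤ = ⊤ := rfl

@[simp] theorem toEReal_coe (p : ℤ) : toEReal (p : EInt) = ((p : ℝ) : EReal) := rfl

theorem coe_lt_top_eint (p : ℤ) : (p : EInt) < ⊤ := lt_top_iff_ne_top.2 (WithBotTop.coe_ne_top p)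

theorem bot_lt_coe_eint (p : ℤ) : (⊥ : EInt) < p := bot_lt_iff_ne_bot.2 (WithBotTop.coe_ne_bot p)

theorem coe_add_one_le_eint {m : ℤ} {p : EInt} : ((m + 1 : ℤ) : EInt) ≤ p ↔ (m : EInt) < p := by
  induction p using WithBotTop.rec with
  | bot => simp
  | coe p => simp
  | top => simp [coe_lt_top_eint]

theorem lt_coe_add_one_eint {m : ℤ} {p : EInt} : p < ((m + 1 : ℤ) : EInt) ↔ p ≤ (m : EInt) := by
  rw [← not_le, coe_add_one_le_eint, not_lt]

theorem eint_ext {p q : EInt} (h : ∀ m : ℤ, (m : EInt) ≤ p ↔ (m : EInt) ≤ q) : p = q := by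
  induction p using WithBotTop.rec with
  | bot =>
    induction q using WithBotTop.rec with
    | bot => rfl
    | coe q => simpa using h q
    | top => simpa using h 0
  | coe p =>
    induction q using WithBotTop.rec with
    | bot => simpa using h p
    | coe q =>
      have h1 := h p
      have h2 := h q
      simp at h1 h2
      rw [le_antisymm h1 h2]
    | top => simpa using h (p + 1)
  | top =>
    induction q using WithBotTop.rec with
    | bot => simpa using h 0
    | coe q => simpa using h (q + 1)
    | top => rfl

/-- The increments in the shift are signs recording on which side of an integer threshold `p` lies.
Both continuity in `p` and the recovery of `p` rest on this. -/
theorem absShift_add_one (p : EInt) (m : ℤ) :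
    absShift p (m + 1) = absShift p m + if ((-m : ℤ) : EInt) ≤ p then 1 else -1 := by
  induction p using WithBotTop.rec with
  | bot => simp; ring
  | coe p => simp; grind
  | top => simp

theorem isClopen_coe_le (m : ℤ) : IsClopen {p : EInt | (m : EInt) ≤ p} := by
  refine ⟨isClosed_Ici, ?_⟩
  have : {p : EInt | (m : EInt) ≤ p} = Set.Ioi ((m - 1 : ℤ) : EInt) := by
    ext p
    rw [Set.mem_Ioi, ← coe_add_one_le_eint, sub_add_cancel]
    rfl
  rw [this]
  exact isOpen_Ioi

theorem continuous_absShift (c : ℤ) : Continuous fun p => absShift p c := by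
  have h : ∀ m : ℤ, Continuous fun p : EInt => if (m : EInt) ≤ p then (1 : ℤ) else -1 := fun m =>
    continuous_if (fun p hp => by
      rw [(isClopen_coe_le m).frontier_eq] at hp
      exact absurd hp (Set.notMem_empty _)) continuousOn_const continuousOn_const
  induction c with
  | zero =>
    have : (fun p => absShift p 0) = fun _ => 0 := by
      ext p
      induction p using WithBotTop.rec <;> simp
    rw [this]
    exact continuous_const
  | succ c ih => simp only [absShift_add_one]; exact ih.add (h _)
  | pred c ih =>
    have := ih.sub (h (-(-c - 1)))
    refine this.congr fun p => ?_
    have h := absShift_add_one p (-c - 1)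
    rw [sub_add_cancel] at h
    change absShift p (-c) - _ = _
    rw [h]
    ring

/-- The lengths that are allowed by `PreOmega`, in terms of the positions of the letters. -/
theorem length_condition_iff {k : ℕ} (p q : EInt) (z : Word k) :
    ((p, q) ≠ ((⊥, ⊥) : EInt × EInt) → (p, q) ≠ ((⊤, ⊤) : EInt × EInt) →
      toEReal q - toEReal p = ((z.length : ENNReal) : EReal)) ↔
    p ≤ q ∧ ∀ (m : ℤ) (n : ℕ), (p ≤ m ∧ ((m + n : ℤ) : EInt) < q → z.letter n ≠ none) ∧
      (m ≤ p ∧ q ≤ ((m + n : ℤ) : EInt) → z.letter n = none) := by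
  have hbot : (⊥ : EReal) ≠ ((z.length : ENNReal) : EReal) := (EReal.coe_ennreal_ne_bot _).symm
  have htop : (⊤ : EReal) = ((z.length : ENNReal) : EReal) ↔ ∀ n, z.letter n ≠ none := by
    rcases z.length_cases with ⟨h, hz⟩ | ⟨N, h, hz⟩
    · simp [h, hz]
    · refine iff_of_false ?_ fun h' => h' N ((h N).2 le_rfl)
      rw [hz, eq_comm, EReal.coe_ennreal_eq_top_iff]
      simp
  have hcoe : ∀ d : ℤ, ((d : ℝ) : EReal) = ((z.length : ENNReal) : EReal) ↔
      0 ≤ d ∧ ∀ n : ℕ, z.letter n = none ↔ d ≤ n := fun d => by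
    rcases z.length_cases with ⟨h, hz⟩ | ⟨N, h, hz⟩
    · refine iff_of_false ?_ fun h' => h d.toNat ((h'.2 _).2 (by omega))
      simp [hz]
    · have hN : ((z.length : ENNReal) : EReal) = ((N : ℝ) : EReal) := by
        rw [hz]
        rfl
      rw [hN, EReal.coe_eq_coe_iff]
      simp only [h]
      constructor
      · intro hd
        have : d = N := by exact_mod_cast hd
        exact ⟨by omega, by omega⟩
      · rintro ⟨h0, h1⟩
        have h2 := h1 N
        have h3 := h1 d.toNat
        have : d = N := by omega
        rw [this]
        simp
  induction p using WithBotTop.rec with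
  | bot =>
    induction q using WithBotTop.rec with
    | bot => simp
    | coe q =>
      simp only [toEReal_bot, toEReal_coe, EReal.sub_bot (EReal.coe_ne_bot _), htop]
      refine ⟨fun h => ⟨bot_le, fun m n => ⟨fun _ => h (by simp) (by simp) n, by simp⟩⟩,
        fun h _ _ n => (h.2 (q - n - 1) n).1 ⟨bot_le, WithBotTop.coe_lt_coe.2 (by omega)⟩⟩
    | top =>
      simp only [toEReal_bot, toEReal_top, EReal.sub_bot top_ne_bot, htop]
      exact ⟨fun h => ⟨bot_le, fun m n => ⟨fun _ => h (by simp) (by simp) n, by simp⟩⟩,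
        fun h _ _ n => (h.2 0 n).1 ⟨bot_le, coe_lt_top_eint _⟩⟩
  | coe p =>
    induction q using WithBotTop.rec with
    | bot =>
      simp only [toEReal_bot, toEReal_coe, EReal.bot_sub]
      exact iff_of_false (fun h => hbot (h (by simp) (by simp)))
        fun h => absurd h.1 (bot_lt_coe_eint p).not_ge
    | coe q =>
      simp only [toEReal_coe, ← EReal.coe_sub, ← Int.cast_sub, hcoe, WithBotTop.coe_le_coe,
        WithBotTop.coe_lt_coe]
      constructor
      · intro h
        obtain ⟨h0, h⟩ := h (by simp) (by simp)
        refine ⟨by omega, fun m n => ⟨fun hm => ?_, fun hm => (h n).2 (by omega)⟩⟩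
        rw [Ne, h n]
        omega
      · rintro ⟨h0, h⟩ - -
        refine ⟨by omega, fun n => ⟨fun hn => ?_, fun hn => (h p n).2 ⟨le_rfl, by omega⟩⟩⟩
        by_contra hlt
        exact (h p n).1 ⟨le_rfl, by omega⟩ hn
    | top =>
      simp only [toEReal_top, toEReal_coe, EReal.top_sub_coe, htop]
      exact ⟨fun h => ⟨le_top, fun m n => ⟨fun _ => h (by simp) (by simp) n, by simp⟩⟩,
        fun h _ _ n => (h.2 p n).1 ⟨le_rfl, coe_lt_top_eint _⟩⟩
  | top =>
    induction q using WithBotTop.rec with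
    | bot => simp [hbot]
    | coe q =>
      refine iff_of_false (fun h => hbot ?_) fun h => absurd h.1 (coe_lt_top_eint q).not_ge
      simpa using h (by simp) (by simp)
    | top => simp

/-- An extended integer vector `(p, q)` with `p ≤ q` that is not constantly infinite decides about
each `n` whether `q - p` exceeds `n`. -/
theorem exists_threshold {p q : EInt} (h : p ≤ q) (hb : (p, q) ≠ ((⊥, ⊥) : EInt × EInt))
    (ht : (p, q) ≠ ((⊤, ⊤) : EInt × EInt)) (n : ℕ) :
    (∃ m : ℤ, p ≤ m ∧ ((m + n : ℤ) : EInt) < q) ∨ ∃ m : ℤ, m ≤ p ∧ q ≤ ((m + n : ℤ) : EInt) := by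
  induction p using WithBotTop.rec with
  | bot =>
    induction q using WithBotTop.rec with
    | bot => exact absurd rfl hb
    | coe q => exact Or.inl ⟨q - n - 1, bot_le, WithBotTop.coe_lt_coe.2 (by omega)⟩
    | top => exact Or.inl ⟨0, by simp, coe_lt_top_eint _⟩
  | coe p =>
    induction q using WithBotTop.rec with
    | bot => exact absurd h (bot_lt_coe_eint p).not_ge
    | coe q =>
      rcases lt_or_ge (p + n) q with h | h
      · exact Or.inl ⟨p, le_rfl, by simpa⟩
      · exact Or.inr ⟨p, le_rfl, by simpa⟩
    | top => exact Or.inl ⟨p, le_rfl, coe_lt_top_eint _⟩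
  | top => exact absurd (by rw [top_le_iff.1 h]) ht

end EInt

/-! ### Topology of the parameter space -/

section Topology

variable {k : ℕ}

/-- The discrete topology on the letters and the end mark. -/
abbrev letterTopology (k : ℕ) : TopologicalSpace (Option (Fin k)) := ⊥

attribute [local instance] letterTopology

theorem discreteTopology_letter (k : ℕ) : DiscreteTopology (Option (Fin k)) := ⟨rfl⟩

attribute [local instance] discreteTopology_letter

theorem isInducing_letter : IsInducing (Word.letter (k := k)) := ⟨rfl⟩

theorem continuous_letter (n : ℕ) : Continuous fun z : Word k => z.letter n :=
  (continuous_apply n).comp isInducing_letter.continuous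

/-- Each defining condition involves two adjacent positions only, hence is closed in a compact
product of finite discrete spaces. -/
instance : CompactSpace (Word k) := by
  have h : IsClosedEmbedding (Word.letter (k := k)) := by
    refine ⟨⟨isInducing_letter, fun z z' h => Word.ext (congrFun h)⟩, ?_⟩
    have : Set.range (Word.letter (k := k)) =
        (⋂ n, {f | f n = none → f (n + 1) = none}) ∩
        ⋂ (n) (i : Fin k) (j : Fin k), {f | f n = some i → f (n + 1) = some j →
          gen i * gen j ≠ delta k} := by
      ext f
      simp only [Set.mem_range, Set.mem_inter_iff, Set.mem_iInter, Set.mem_ofPred_eq]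
      exact ⟨by rintro ⟨z, rfl⟩; exact ⟨z.ended, z.deltaFree⟩, fun h => ⟨⟨f, h.1, h.2⟩, rfl⟩⟩
    rw [this]
    have hc : ∀ s : Set (Option (Fin k) × Option (Fin k)), ∀ n,
        IsClosed {f : ℕ → Option (Fin k) | (f n, f (n + 1)) ∈ s} := fun s n =>
      (isClosed_discrete s).preimage ((continuous_apply n).prodMk (continuous_apply (n + 1)))
    refine (isClosed_iInter fun n => hc {x | x.1 = none → x.2 = none} n).inter ?_
    refine isClosed_iInter fun n => isClosed_iInter fun i => isClosed_iInter fun j => ?_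
    exact hc {x | x.1 = some i → x.2 = some j → gen i * gen j ≠ delta k} n
  exact h.compactSpace

theorem isLocallyConstant_take (n : ℕ) : IsLocallyConstant fun z : Word k => z.take n := by
  induction n with
  | zero => exact IsLocallyConstant.const _
  | succ n ih =>
    simp only [Word.take_succ]
    exact ih.comp₂ ((IsLocallyConstant.iff_continuous _).2 (continuous_letter n))
      fun l o => l ++ o.toList

theorem PreOmega.spec (x : PreOmega k) : x.1.1.1 ≤ x.1.1.2 ∧ ∀ (m : ℤ) (n : ℕ),
    (x.1.1.1 ≤ m ∧ ((m + n : ℤ) : EInt) < x.1.1.2 → x.1.2.letter n ≠ none) ∧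
      (m ≤ x.1.1.1 ∧ x.1.1.2 ≤ ((m + n : ℤ) : EInt) → x.1.2.letter n = none) :=
  (length_condition_iff _ _ _).1 x.2

/-- The difference of extended integers is not continuous at the infinite corners. The threshold
form of the length condition is an intersection of implications with open hypothesis and closed
conclusion. -/
instance : CompactSpace (PreOmega k) := by
  have h : IsClosed {x : (EInt × EInt) × Word k | x.1 ≠ (⊥, ⊥) → x.1 ≠ (⊤, ⊤) →
      toEReal x.1.2 - toEReal x.1.1 = ((x.2.length : ENNReal) : EReal)} := by
    have : {x : (EInt × EInt) × Word k | x.1 ≠ (⊥, ⊥) → x.1 ≠ (⊤, ⊤) →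
        toEReal x.1.2 - toEReal x.1.1 = ((x.2.length : ENNReal) : EReal)} =
        {x | x.1.1 ≤ x.1.2} ∩ ⋂ (m : ℤ) (n : ℕ),
          ({x | x.1.1 ≤ (m : EInt) ∧ ((m + n : ℤ) : EInt) < x.1.2 → x.2.letter n ≠ none} ∩
            {x | (m : EInt) ≤ x.1.1 ∧ x.1.2 ≤ ((m + n : ℤ) : EInt) → x.2.letter n = none}) := by
      ext x
      simp only [Set.mem_inter_iff, Set.mem_iInter, Set.mem_ofPred_eq]
      exact length_condition_iff x.1.1 x.1.2 x.2
    rw [this]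
    have h0 : Continuous fun x : (EInt × EInt) × Word k => x.1.1 := by fun_prop
    have h1 : Continuous fun x : (EInt × EInt) × Word k => x.1.2 := by fun_prop
    have hl : ∀ (n : ℕ) (s : Set (Option (Fin k))),
        IsClosed {x : (EInt × EInt) × Word k | x.2.letter n ∈ s} := fun n s =>
      (isClosed_discrete s).preimage ((continuous_letter n).comp continuous_snd)
    refine (isClosed_le h0 h1).inter (isClosed_iInter fun m => isClosed_iInter fun n => ?_)
    refine IsClosed.inter (isClosed_imp ?_ (hl n {none}ᶜ)) (isClosed_imp ?_ (hl n {none}))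
    · simp only [← lt_coe_add_one_eint]
      exact (isOpen_lt h0 continuous_const).inter (isOpen_lt continuous_const h1)
    · simp only [← lt_coe_add_one_eint]
      exact ((isClopen_coe_le m).2.preimage h0).inter (isOpen_lt h1 continuous_const)
  exact h.isClosedEmbedding_subtypeVal.compactSpace

variable [NeZero k]

theorem continuous_phiWord (hk : 3 ≤ k) (w : Grp k) : Continuous (phiWord (k := k) w) := by
  obtain ⟨N, hN⟩ := exists_phiWord_eq hk w
  have h : phiWord w = (fun l => phi w (wordProd l)) ∘ fun z : Word k => z.take N :=
    funext fun z => hN z N le_rfl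
  rw [h]
  exact ((isLocallyConstant_take N).comp _).continuous

theorem continuous_psi (hk : 3 ≤ k) : Continuous (psi (k := k)) := by
  have h : Continuous fun x : EInt × ℤ => absShift x.1 x.2 :=
    continuous_prod_of_discrete_right.2 continuous_absShift
  have hv : Continuous fun x : PreOmega k => x.1 := continuous_subtype_val
  refine continuous_pi fun w => ?_
  have hw : Continuous fun x : PreOmega k => phiWord w x.1.2 :=
    (continuous_phiWord hk w).comp (continuous_snd.comp hv)
  refine Continuous.add ?_ ?_
  · exact h.comp ((continuous_fst.comp (continuous_fst.comp hv)).prodMk (continuous_fst.comp hw))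
  · exact h.comp ((continuous_snd.comp (continuous_fst.comp hv)).prodMk (continuous_snd.comp hw))

end Topology

/-! ### Injectivity -/

section Injectivity

variable {k : ℕ} [NeZero k]

theorem psi_eq_of_equiv (hk : 3 ≤ k) {x y : PreOmega k} (h : x ≈ y) : psi x = psi y := by
  rcases h with rfl | ⟨hx, hy⟩ | ⟨hx, hy⟩
  · rfl
  all_goals
    ext w
    have h1 := phiWord_fst_add_snd hk w x.1.2
    have h2 := phiWord_fst_add_snd hk w y.1.2
    simp only [psi, hx, hy, absShift_bot, absShift_top]
    linarith

/-- Powers of `δ` move both coordinates equally whatever `z` is, so they probe `p` alone. -/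
theorem phiWord_delta_zpow (hk : 3 ≤ k) (m : ℤ) (z : Word k) :
    phiWord (delta k ^ (-m)) z = (m, m) := by
  obtain ⟨N, hN⟩ := exists_phiWord_eq hk (delta k ^ (-m))
  rw [hN z N le_rfl, phi, ← zpow_neg, neg_neg, piMap_delta_zpow_mul, add_sub_cancel_left]

/-- The inverse of the test element strips `n` letters from `z` and puts `i` in front of the rest:
the result reveals whether the next letter is `i + 1`. The power of `δ` places the reading at a
chosen threshold of `p`. -/
theorem phiWord_prefixProd_mul (hk : 3 ≤ k) (z : Word k) {n : ℕ} {i j : Fin k} (m : ℤ)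
    (h : z.letter n = some j) :
    phiWord (z.prefixProd n * (gen i)⁻¹ * delta k ^ (-m)) z =
      (m, m - n) + if j = i + 1 then (1, 0) else (0, 1) := by
  obtain ⟨N, hN⟩ := exists_phiWord_eq hk (z.prefixProd n * (gen i)⁻¹ * delta k ^ (-m))
  rw [hN z (max N (n + 1)) (le_max_left _ _)]
  obtain ⟨v, hv, -⟩ := z.exists_take_append (show n ≤ max N (n + 1) by omega)
  have hl : (z.take n).length = n := z.length_take fun m hm =>
    z.letter_ne_none_of_le (n := n) (by simp [h]) hm.le
  have hf : DeltaFree (z.take n ++ v) := hv ▸ z.deltaFree_take _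
  have hj : v.head? = some j := by
    have h1 := z.take_getElem? (max N (n + 1)) n
    rw [if_pos (by omega), h, hv, List.getElem?_append_right hl.le, hl, Nat.sub_self] at h1
    rw [List.head?_eq_getElem?, h1]
  have hg : (z.prefixProd n * (gen i)⁻¹ * delta k ^ (-m))⁻¹ * wordProd (z.take n ++ v) =
      delta k ^ m * (gen i * wordProd v) := by
    rw [wordProd_append, Word.prefixProd_eq]
    group
  rw [phi, Word.prefixProd_eq z (max _ _), hv, hg, piMap_delta_zpow_mul, piMap_gen_mul,
    nf_wordProd hf.right_of_append, hj, piMap_wordProd hf.right_of_append, piMap_wordProd hf,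
    List.length_append, hl]
  simp only [Option.some_inj]
  split_ifs <;> ext <;> simp <;> ring

theorem eq_of_psi_eq (hk : 3 ≤ k) {x y : PreOmega k} (h : psi x = psi y) : x.1.1 = y.1.1 := by
  have hm : ∀ m : ℤ, ((m : EInt) ≤ x.1.1.1 ↔ (m : EInt) ≤ y.1.1.1) ∧
      ((m : EInt) ≤ x.1.1.2 ↔ (m : EInt) ≤ y.1.1.2) := fun m => by
    -- Subtracting the two values leaves the sum of the signs of `m ≤ p_0` and `m ≤ p_1`. As `p_0 ≤
    -- p_1`, this sum determines both.
    have h1 := congrFun h (delta k ^ (-(-m)))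
    have h2 := congrFun h (delta k ^ (-(-m + 1)))
    simp only [psi, phiWord_delta_zpow hk, absShift_add_one] at h1 h2
    rw [neg_neg] at h2
    have hx : (m : EInt) ≤ x.1.1.1 → (m : EInt) ≤ x.1.1.2 := fun h => h.trans x.spec.1
    have hy : (m : EInt) ≤ y.1.1.1 → (m : EInt) ≤ y.1.1.2 := fun h => h.trans y.spec.1
    grind
  exact Prod.ext (eint_ext fun m => (hm m).1) (eint_ext fun m => (hm m).2)

theorem equiv_of_psi_eq (hk : 3 ≤ k) {x y : PreOmega k} (h : psi x = psi y) : x ≈ y := by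
  have hp := eq_of_psi_eq hk h
  by_cases hb : x.1.1 = (⊥, ⊥)
  · exact Or.inr (Or.inl ⟨hb, hp ▸ hb⟩)
  by_cases ht : x.1.1 = (⊤, ⊤)
  · exact Or.inr (Or.inr ⟨ht, hp ▸ ht⟩)
  refine Or.inl (Subtype.ext (Prod.ext hp (Word.ext fun n => ?_)))
  induction n using Nat.strong_induction_on with
  | _ n ih =>
    rcases exists_threshold x.spec.1 hb ht n with ⟨m, hm⟩ | ⟨m, hm⟩
    · obtain ⟨j, hj⟩ := Option.ne_none_iff_exists'.1 ((x.spec.2 m n).1 hm)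
      obtain ⟨j', hj'⟩ := Option.ne_none_iff_exists'.1 ((y.spec.2 m n).1 (hp ▸ hm))
      rw [hj, hj', Option.some_inj]
      by_contra hne
      have hji : j = j - 1 + 1 := by grind
      -- With `i = j - 1` the letter raises the first coordinate for `x` and the second for `y`. At
      -- the shift `-m - 1` the two increments are `-1` and `1`, because `p_0 ≤ m` and `m + n <
      -- p_1`.
      have h1 := congrFun h (x.1.2.prefixProd n * (gen (j - 1))⁻¹ * delta k ^ (-(-m - 1)))
      have hx := phiWord_prefixProd_mul hk x.1.2 (i := j - 1) (-m - 1) hj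
      have hy := phiWord_prefixProd_mul hk y.1.2 (i := j - 1) (-m - 1) hj'
      rw [Word.prefixProd_eq, ← Word.take_congr ih, ← Word.prefixProd_eq, ← hji,
        if_neg (Ne.symm hne)] at hy
      rw [← hji, if_pos rfl] at hx
      simp only [psi, hx, hy, ← hp, Prod.fst_add, Prod.snd_add, absShift_add_one, add_zero] at h1
      rw [if_neg, if_pos] at h1
      · omega
      · rw [show -(-m - 1 - (n : ℤ)) = m + n + 1 by ring, coe_add_one_le_eint]
        exact hm.2
      · rw [show -(-m - 1) = m + 1 by ring, coe_add_one_le_eint, not_lt]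
        exact hm.1
    · rw [(x.spec.2 m n).2 hm, (y.spec.2 m n).2 (hp ▸ hm)]

end Injectivity
end DihedralArtin

namespace DihedralArtin

/-! ### The image of `ψ̃` -/

section Image

variable {k : ℕ} [NeZero k]

theorem distFun_wordProd_mul {l : List (Fin k)} (h : DeltaFree l) (r : ℤ) (w : Grp k) :
    distFun (wordProd l * delta k ^ r) w = absShift (r : EInt) (phi w (wordProd l)).1 +
      absShift ((l.length + r : ℤ) : EInt) (phi w (wordProd l)).2 := by
  have hphi : phi w (wordProd l * delta k ^ r) = phi w (wordProd l) := by
    rw [phi, phi, ← mul_assoc, piMap_mul_delta_zpow, piMap_mul_delta_zpow, add_sub_add_right_eq_sub]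
  rw [distFun_eq, hphi, piMap_mul_delta_zpow, piMap_wordProd h]
  simp
  ring

theorem distFun_mem_range_psi (hk : 3 ≤ k) (x : Grp k) : distFun x ∈ Set.range (psi (k := k)) := by
  have hx := eval_nf x
  have hl := (nf x).2
  generalize (nf x).1 = y at hx hl
  obtain ⟨l, r⟩ := y
  refine ⟨⟨(((r : EInt), ((l.length + r : ℤ) : EInt)), Word.ofList l hl), fun _ _ => ?_⟩, ?_⟩
  · simp only [toEReal_coe, Word.length_ofList, ← EReal.coe_sub]
    simp
    rfl
  · ext w
    rw [← hx, eval, distFun_wordProd_mul hl]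
    simp only [psi, phiWord_ofList hk]

/-- Approximation by the group elements `z_1 ⋯ z_{N n} δ^{r n}`: once the prefix is long enough for
`φ̃(w, ·)` to stabilise, only the coordinates of `π̃` matter. -/
theorem psi_mem_closure (hk : 3 ≤ k) (x : PreOmega k) (r : ℕ → ℤ) (N : ℕ → ℕ)
    (hN : Tendsto N atTop atTop)
    (h0 : ∀ c, ∀ᶠ n in atTop, absShift (r n : EInt) c = absShift x.1.1.1 c)
    (h1 : ∀ c, ∀ᶠ n in atTop,
      absShift (((x.1.2.take (N n)).length + r n : ℤ) : EInt) c = absShift x.1.1.2 c) :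
    psi x ∈ horoCompactification k := by
  refine mem_closure_of_tendsto (b := atTop)
    (f := fun n => distFun (wordProd (x.1.2.take (N n)) * delta k ^ r n)) ?_
    (Eventually.of_forall fun n => Set.mem_range_self _)
  refine tendsto_pi_nhds.2 fun w => tendsto_const_nhds.congr' ?_
  obtain ⟨M, hM⟩ := exists_phiWord_eq hk w
  filter_upwards [hN.eventually_ge_atTop M, h0 (phiWord w x.1.2).1, h1 (phiWord w x.1.2).2]
    with n hn hn0 hn1
  rw [distFun_wordProd_mul (x.1.2.deltaFree_take _), ← Word.prefixProd_eq, ← hM x.1.2 _ hn, hn0,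
    hn1, psi]

theorem absShift_of_le {p c : ℤ} (h : |c| ≤ p) : absShift (p : EInt) c = absShift ⊤ c := by
  simp only [absShift_coe, absShift_top]
  grind

theorem absShift_of_ge {p c : ℤ} (h : p ≤ -|c|) : absShift (p : EInt) c = absShift ⊥ c := by
  simp only [absShift_coe, absShift_bot]
  grind

theorem psi_mem_horoCompactification (hk : 3 ≤ k) (x : PreOmega k) :
    psi x ∈ horoCompactification k := by
  have hlen : ∀ n, (x.1.2.take n).length ≤ n := fun n =>
    (List.length_filterMap_le _ _).trans List.length_range.le
  have hfull : (∀ n, x.1.2.letter n ≠ none) → ∀ n, (x.1.2.take n).length = n :=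
    fun h n => x.1.2.length_take fun m _ => h m
  have habs : ∀ c : ℤ, ∀ᶠ n : ℕ in atTop, |c| ≤ n := fun c =>
    (eventually_ge_atTop c.natAbs).mono fun n hn => by rw [Int.abs_eq_natAbs]; omega
  have key := psi_mem_closure hk x
  have hspec := x.spec
  generalize x.1.1 = p at key hspec
  obtain ⟨p, q⟩ := p
  dsimp only at key hspec
  induction p using WithBotTop.rec with
  | bot =>
    induction q using WithBotTop.rec with
    | bot =>
      -- The prefix has at most `n` letters, so the second coordinate is at most `-n`.
      refine key (fun n => -(2 * n)) id tendsto_id (fun c => ?_) fun c => ?_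
      · filter_upwards [habs c] with n hn
        exact absShift_of_ge (by omega)
      · filter_upwards [habs c] with n hn
        have := hlen n
        exact absShift_of_ge (by simp only [id]; omega)
    | coe q =>
      have hf := hfull fun n => (hspec.2 (q - n - 1) n).1
        ⟨bot_le, WithBotTop.coe_lt_coe.2 (by omega)⟩
      -- The prefix has exactly `n` letters, so the second coordinate stays equal to `q`.
      refine key (fun n => q - n) id tendsto_id (fun c => ?_) fun c => ?_
      · filter_upwards [habs (|c| + |q|)] with n hn
        exact absShift_of_ge (by grind)
      · simp [hf]
    | top =>
      have hf := hfull fun n => (hspec.2 0 n).1 ⟨bot_le, coe_lt_top_eint _⟩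
      -- Prefixes of length `2n` send the coordinates to `-n` and `n`.
      refine key (fun n => -n) (fun n => n + n) (tendsto_id.atTop_add_atTop tendsto_id)
        (fun c => ?_) fun c => ?_
      · filter_upwards [habs c] with n hn
        exact absShift_of_ge (by omega)
      · filter_upwards [habs c] with n hn
        exact absShift_of_le (by rw [hf]; push_cast; omega)
  | coe p =>
    induction q using WithBotTop.rec with
    | bot => exact absurd hspec.1 (bot_lt_coe_eint p).not_ge
    | coe q =>
      have hpq : p ≤ q := WithBotTop.coe_le_coe.1 hspec.1
      obtain ⟨d, rfl⟩ := Int.le.dest hpq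
      have hd : ∀ n ≥ d, (x.1.2.take n).length = d := fun n hn => by
        rw [x.1.2.take_of_letter_eq_none ((hspec.2 p d).2 ⟨le_rfl, le_rfl⟩) hn]
        exact x.1.2.length_take fun m hm =>
          (hspec.2 p m).1 ⟨le_rfl, WithBotTop.coe_lt_coe.2 (by omega)⟩
      refine key (fun _ => p) id tendsto_id (fun c => by simp) fun c => ?_
      filter_upwards [eventually_ge_atTop d] with n hn
      rw [id, hd n hn, add_comm]
    | top =>
      have hf := hfull fun n => (hspec.2 p n).1 ⟨le_rfl, coe_lt_top_eint _⟩
      refine key (fun _ => p) id tendsto_id (fun c => by simp) fun c => ?_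
      filter_upwards [habs (|c| + |p|)] with n hn
      exact absShift_of_le (by rw [id, hf]; grind)
  | top =>
    obtain rfl := top_le_iff.1 hspec.1
    refine key (fun n => n) id tendsto_id (fun c => ?_) fun c => ?_
    · filter_upwards [habs c] with n hn
      exact absShift_of_le hn
    · filter_upwards [habs c] with n hn
      exact absShift_of_le (by omega)

theorem range_psi (hk : 3 ≤ k) : Set.range (psi (k := k)) = horoCompactification k := by
  refine Set.Subset.antisymm ?_ ?_
  · rintro _ ⟨x, rfl⟩
    exact psi_mem_horoCompactification hk x
  · refine closure_minimal ?_ (isCompact_range (continuous_psi hk)).isClosed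
    rintro _ ⟨x, rfl⟩
    exact distFun_mem_range_psi hk x

/-- The map `ψ̃` on the quotient space, with values in the horofunction compactification. -/
noncomputable def psiQuotient (hk : 3 ≤ k) : Omega k → horoCompactification k :=
  Quotient.lift (fun x => ⟨psi x, psi_mem_horoCompactification hk x⟩)
    fun _ _ h => Subtype.ext (psi_eq_of_equiv hk h)

theorem psiQuotient_bijective (hk : 3 ≤ k) : Function.Bijective (psiQuotient hk) := by
  constructor
  · intro x y
    refine Quotient.inductionOn₂ x y fun x y h => Quotient.sound ?_
    exact equiv_of_psi_eq hk (congrArg Subtype.val h)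
  · rintro ⟨f, hf⟩
    rw [← range_psi hk] at hf
    obtain ⟨x, rfl⟩ := hf
    exact ⟨Quotient.mk _ x, rfl⟩

theorem continuous_psiQuotient (hk : 3 ≤ k) : Continuous (psiQuotient hk) :=
  ((continuous_psi hk).subtype_mk _).quotient_lift _

end Image
end DihedralArtin

theorem mainTheorem8 (k : ℕ) (hk : 3 ≤ k) :
    (∀ (w : DihedralArtin.Grp k) (z : DihedralArtin.Word k), ∃ l : ℤ × ℤ,
      Filter.Tendsto (fun n => DihedralArtin.phi w (z.prefixProd n)) Filter.atTop (nhds l)) ∧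
    ∃ Ψ : DihedralArtin.Omega k ≃ₜ DihedralArtin.horoCompactification k,
      ∀ x : DihedralArtin.PreOmega k,
        (Ψ (Quotient.mk (DihedralArtin.omegaSetoid k) x) : DihedralArtin.Grp k → ℤ) =
          DihedralArtin.psi x := by
  have : NeZero k := ⟨by omega⟩
  refine ⟨fun w z => ⟨_, DihedralArtin.tendsto_phi_prefixProd hk w z⟩, ?_⟩
  have hcont : Continuous (Equiv.ofBijective _ (DihedralArtin.psiQuotient_bijective hk)) :=
    DihedralArtin.continuous_psiQuotient hk
  exact ⟨hcont.homeoOfEquivCompactToT2, fun x => rfl⟩
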